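/- Let $m>n$, let $X\subset\mathbb R^m$ be open and bounded and let $Y\subset\mathbb R^n$ be open, bounded and convex. Let $c\in C^2(\bar X\times\bar Y)$, $V\in C^2(\bar Y)$ and $W\in C^2(\bar Y\times\bar Y)$ with $W(y,z)=W(z,y)$ (derivatives at boundary points of $Y$ are taken within $\bar Y$). Assume (i) (uniform convexity) there is a constant $C>0$ such that $D^2_{yy}c(x,y)+D^2V(y)+D^2_{yy}W(z,y)\ge C\,\mathrm{Id}$ for all $x\in X$ and $y,z\in Y$; (ii) (outward gradient) $[D_yc(x,y)+DV(y)+D_yW(y,z)]\cdot \mathbf n\ge 0$ for all $x\in X$, $z\in Y$, $y\in\partial Y$ and every outward unit normal $\mathbf n$ to $Y$ at $y$, i.e. every unit vector with $\mathbf n\cdot(w-y)\le 0$ for all $w\in Y$. Let $\mu$ be a Borel probability measure on $\bar X$, let $\mathcal T_c(\mu,\nu)=\inf_{\gamma\in\Pi(\mu,\nu)}\int c\,d\gamma$, where $\Pi(\mu,\nu)$ is the set of measures on the product with marginals $\mu,\nu$, and let $\nu$ be any minimizer of $$\nu\mapsto \mathcal T_c(\mu,\nu)+\int V\,d\nu+\tfrac12\iint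 W(y,z)\,d\nu(z)\,d\nu(y)$$ over Borel probability measures on $\bar Y$. A pair of Kantorovich potentials is a maximizer $(u,v)$ of $\int u\,d\mu+\int v\,d\nu$ among integrable pairs with $u(x)+v(y)\le c(x,y)$ on $\bar X\times\bar Y$ such that $u(x)=\min_{y\in\bar Y}[c(x,y)-v(y)]$ on $\bar X$ and $v(y)=\min_{x\in\bar X}[c(x,y)-u(x)]$ on $\bar Y$. Such a pair is called nested if for $\nu$-almost every $y$ the function $v$ is differentiable at $y$ (within $\bar Y$) and $$\{x\in\bar X: u(x)+v(y)=c(x,y)\}=\{x\in\bar X: D_yc(x,y)=Dv(y)\}.$$ The model $(c,\mu,\nu)$ satisfies the generalized nestedness condition if Kantorovich potentials exist and every pair of them is nested. Then: 1. There is a nested pair of Kantorovich potentials. If the Kantorovich potentials are unique up to $(u,v)\mapsto(u+a,v-a)$, $a\in\mathbb R$, then $(c,\mu,\nu)$ satisfies the generalized nestedness condition. In particular, if $X$ is connected and Lebesgue measure on $X$ is absolutely continuous with respect to $\mu$ (for example, if $\mu$ has a density that is positive on $X$), then the potentials are unique up to constants and $(c,\mu,\nu)$ satisfies the generalized nestedness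 condition. 2. There is a map $T:\bar X\to\bar Y$, unique up to $\mu$-null sets, with $T_\#\mu=\nu$ and $\int c(x,T(x))\,d\mu(x)=\mathcal T_c(\mu,\nu)$, and it can be chosen such that, for every integer $k\ge2$, if $c,V,W$ are of class $C^k$ (on $\bar X\times\bar Y$, $\bar Y$, $\bar Y\times\bar Y$), then $T$ is of class $C^{k-1}$ on $\bar X$. -/

import Mathlib

open MeasureTheory

noncomputable section

/-- Probability measures concentrated on `S`, i.e. the elements of `P(S)`, seen as measures on the
ambient space. -/
def ProbOn {E : Type*} [MeasurableSpace E] (S : Set E) : Set (Measure E) :=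
  {ρ | IsProbabilityMeasure ρ ∧ ρ Sᶜ = 0}

/-- `Π(μ, ν)`: measures on the product with marginals `μ` and `ν`. -/
def Couplings {E F : Type*} [MeasurableSpace E] [MeasurableSpace F]
    (μ : Measure E) (ν : Measure F) : Set (Measure (E × F)) :=
  {γ | γ.map Prod.fst = μ ∧ γ.map Prod.snd = ν}

/-- The optimal transport cost `T_c(μ, ν) = inf_{γ ∈ Π(μ, ν)} ∫ c dγ`. -/
def transportCost {E F : Type*} [MeasurableSpace E] [MeasurableSpace F]
    (c : E → F → ℝ) (μ : Measure E) (ν : Measure F) : ℝ :=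
  sInf ((fun γ : Measure (E × F) => ∫ p, c p.1 p.2 ∂γ) '' Couplings μ ν)

/-- `T` is an optimal map from `μ` to `ν`: it pushes `μ` forward to `ν` and the plan it induces
attains the optimal transport cost. -/
def IsOptimalMap {E F : Type*} [MeasurableSpace E] [MeasurableSpace F]
    (c : E → F → ℝ) (μ : Measure E) (ν : Measure F) (T : E → F) : Prop :=
  AEMeasurable T μ ∧ μ.map T = ν ∧ ∫ x, c x (T x) ∂μ = transportCost c μ ν

/-- Competitors in the dual problem: integrable `u`, `v` with `u(x) + v(y) ≤ c(x, y)`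
on `closure X × closure Y`. -/
def DualAdmissible {E F : Type*} [MeasurableSpace E] [MeasurableSpace F]
    [TopologicalSpace E] [TopologicalSpace F] (X : Set E) (Y : Set F)
    (c : E → F → ℝ) (μ : Measure E) (ν : Measure F) (u : E → ℝ) (v : F → ℝ) : Prop :=
  Integrable u μ ∧ Integrable v ν ∧ ∀ x ∈ closure X, ∀ y ∈ closure Y, u x + v y ≤ c x y

/-- `(u, v)` is a pair of Kantorovich potentials: it solves the dual problem, and `u` and `v` are
the `c`-transforms of each other (with attained minima).  Only the values of `u` on `closure X`
and of `v` on `closure Y` matter. -/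
def IsKantorovichPair {E F : Type*} [MeasurableSpace E] [MeasurableSpace F]
    [TopologicalSpace E] [TopologicalSpace F] (X : Set E) (Y : Set F)
    (c : E → F → ℝ) (μ : Measure E) (ν : Measure F) (u : E → ℝ) (v : F → ℝ) : Prop :=
  DualAdmissible X Y c μ ν u v ∧
  (∀ u' v', DualAdmissible X Y c μ ν u' v' →
    ∫ x, u' x ∂μ + ∫ y, v' y ∂ν ≤ ∫ x, u x ∂μ + ∫ y, v y ∂ν) ∧
  (∀ x ∈ closure X, IsLeast ((fun y => c x y - v y) '' closure Y) (u x)) ∧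
  (∀ y ∈ closure Y, IsLeast ((fun x => c x y - u x) '' closure X) (v y))

/-- The Kantorovich potentials are unique up to `(u, v) ↦ (u + a, v - a)`. -/
def UniqueKantorovichPair {E F : Type*} [MeasurableSpace E] [MeasurableSpace F]
    [TopologicalSpace E] [TopologicalSpace F] (X : Set E) (Y : Set F)
    (c : E → F → ℝ) (μ : Measure E) (ν : Measure F) : Prop :=
  ∀ u v u' v', IsKantorovichPair X Y c μ ν u v → IsKantorovichPair X Y c μ ν u' v' →
    ∃ a : ℝ, (∀ x ∈ closure X, u' x = u x + a) ∧ (∀ y ∈ closure Y, v' y = v y - a)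

/-- The `c`-superdifferential `∂ᶜv(y) = {x : u(x) + v(y) = c(x, y)}`. -/
def cSuperdiff {E F : Type*} [TopologicalSpace E] (X : Set E)
    (c : E → F → ℝ) (u : E → ℝ) (v : F → ℝ) (y : F) : Set E :=
  {x | x ∈ closure X ∧ u x + v y = c x y}

/-- The level set `X₌(y, p) = {x : D_y c(x, y) = p}`.  Derivatives at boundary points of `Y` are
taken within `closure Y` (for `y` in the open set `Y` this is the usual derivative). -/
def levelSet {E F : Type*} [TopologicalSpace E] [NormedAddCommGroup F] [NormedSpace ℝ F]
    (X : Set E) (Y : Set F) (c : E → F → ℝ) (y : F) (p : F →L[ℝ] ℝ) : Set E :=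
  {x | x ∈ closure X ∧ fderivWithin ℝ (c x) (closure Y) y = p}

/-- The nestedness condition for a given pair `(u, v)`: for `ν`-almost every `y`, the function `v`
is differentiable at `y` and `∂ᶜv(y) = X₌(y, Dv(y))`. -/
def NestedFor {E F : Type*} [TopologicalSpace E] [NormedAddCommGroup F] [NormedSpace ℝ F]
    [MeasurableSpace F] (X : Set E) (Y : Set F) (c : E → F → ℝ) (ν : Measure F)
    (u : E → ℝ) (v : F → ℝ) : Prop :=
  ∀ᵐ y ∂ν, DifferentiableWithinAt ℝ v (closure Y) y ∧
    cSuperdiff X c u v y = levelSet X Y c y (fderivWithin ℝ v (closure Y) y)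

/-- The model `(c, μ, ν)` is generalized nested: Kantorovich potentials exist and all of them
satisfy the nestedness condition. -/
def GeneralizedNested {E F : Type*} [TopologicalSpace E] [MeasurableSpace E]
    [NormedAddCommGroup F] [NormedSpace ℝ F] [MeasurableSpace F]
    (X : Set E) (Y : Set F) (c : E → F → ℝ) (μ : Measure E) (ν : Measure F) : Prop :=
  (∃ u v, IsKantorovichPair X Y c μ ν u v) ∧
  ∀ u v, IsKantorovichPair X Y c μ ν u v → NestedFor X Y c ν u v

/-- The functional `ν ↦ T_c(μ, ν) + ∫ V dν + (1/2) ∬ W dν dν`. -/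
def energy {E F : Type*} [MeasurableSpace E] [MeasurableSpace F]
    (c : E → F → ℝ) (V : F → ℝ) (W : F → F → ℝ) (μ : Measure E) (ν : Measure F) : ℝ :=
  transportCost c μ ν + ∫ y, V y ∂ν + (1 / 2 : ℝ) * ∫ y, ∫ z, W y z ∂ν ∂ν

/-- The second derivative `D²f(y)[h, h]`. -/
def secondDeriv {F : Type*} [NormedAddCommGroup F] [NormedSpace ℝ F]
    (f : F → ℝ) (y h : F) : ℝ :=
  fderiv ℝ (fderiv ℝ f) y h h

/-- `D²_{yy} c(x, y) + D² V(y) + D²_{yy} W(z, y) ≥ C > 0` on `X × Y × Y`. -/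
def UniformConvexity {E F : Type*} [NormedAddCommGroup F] [NormedSpace ℝ F]
    (X : Set E) (Y : Set F) (c : E → F → ℝ) (V : F → ℝ) (W : F → F → ℝ) : Prop :=
  ∃ C : ℝ, 0 < C ∧ ∀ x ∈ X, ∀ y ∈ Y, ∀ z ∈ Y, ∀ h : F,
    C * ‖h‖ ^ 2 ≤ secondDeriv (c x) y h + secondDeriv V y h + secondDeriv (W z) y h

/-- `p` is an outward unit normal at `y` to the convex set `Y`. -/
def IsOutwardUnitNormal {F : Type*} [NormedAddCommGroup F] [InnerProductSpace ℝ F]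
    (Y : Set F) (y p : F) : Prop :=
  ‖p‖ = 1 ∧ ∀ w ∈ Y, inner ℝ p (w - y) ≤ 0

/-- `[D_y c(x, y) + D V(y) + D_y W(y, z)] · n ≥ 0` for `x ∈ X`, `z ∈ Y`, `y ∈ ∂Y` and
outward unit normals `n` to `Y` at `y`. -/
def OutwardGradient {E F : Type*} [NormedAddCommGroup F] [InnerProductSpace ℝ F]
    (X : Set E) (Y : Set F) (c : E → F → ℝ) (V : F → ℝ) (W : F → F → ℝ) : Prop :=
  ∀ x ∈ X, ∀ z ∈ Y, ∀ y ∈ frontier Y, ∀ p, IsOutwardUnitNormal Y y p →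
    0 ≤ fderivWithin ℝ (c x) (closure Y) y p + fderivWithin ℝ V (closure Y) y p
      + fderivWithin ℝ (fun y' => W y' z) (closure Y) y p

/-- `c`, `V` and `W` are of class `C^k` up to the boundary. -/
def SmoothData {E F : Type*} [NormedAddCommGroup E] [NormedSpace ℝ E]
    [NormedAddCommGroup F] [NormedSpace ℝ F] (k : ℕ)
    (X : Set E) (Y : Set F) (c : E → F → ℝ) (V : F → ℝ) (W : F → F → ℝ) : Prop :=
  ContDiffOn ℝ k (Function.uncurry c) (closure X ×ˢ closure Y) ∧
  ContDiffOn ℝ k V (closure Y) ∧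
  ContDiffOn ℝ k (Function.uncurry W) (closure Y ×ˢ closure Y)

end

/-! Fix a minimizer `ν` and put `Φ = V + ∫ W(·, z) dν(z)`. Averaging hypothesis (i) against `ν`
makes each `y ↦ c(x, y) + Φ(y)` uniformly convex on `closure Y`; averaging (ii) makes its minimum a
critical point even on the boundary. So each `x` has exactly one solution `T x` of `D_y c(x, y) =
-DΦ(y)`, and `c(x, y) + Φ(y)` exceeds its minimum by at least `C/2 ‖y - T x‖²`. The implicit
function theorem gives the regularity of `T` (`contDiffOn_argmin`).

The first variation of the energy towards `T_#μ` (`energy_first_variation`) bounds `T_c(μ, ν) + ∫ Φ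
dν` by `∫ (c(x, T x) + Φ(T x)) dμ`. Integrating the quadratic growth against a nearly optimal plan
then makes its mean squared distance to the graph of `T` arbitrarily small. Hence `T_#μ = ν`, and
`T` is optimal and unique (`map_eq`, `cost_eq`, `ae_eq_of_isOptimalMap`).

For the potentials take `u(x) = c(x, T x) + Φ(T x)` and its conjugate `v`. Then `v ≥ -Φ`, with
equality on the image of `T`, which carries `ν`. At `T x₀`, `v` is squeezed between `-Φ` and `c(x₀,
·) - u(x₀)`, which have the same derivative there; so `Dv = -DΦ`, and both sets in the nestedness
condition are the fibre of `T` (`nestedFor`).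

Any pair of potentials saturates its constraint along `T`. When Lebesgue measure on `X` is
absolutely continuous with respect to `μ`, this holds on all of `X`, and comparing two pairs along
the continuous map `T` shows that the difference of their `u` has zero derivative
(`hasFDerivAt_sub_eq_zero`). -/

/-! ### Partial derivatives and parametric integrals up to the boundary. -/

section ParametricCalculus
open Set Filter Topology

/-- The partial derivative in the second variable of a `C^(j+1)` function on a product. -/
theorem contDiffOn_fderivWithin_right {A B G : Type*} [NormedAddCommGroup A] [NormedSpace ℝ A]
    [NormedAddCommGroup B] [NormedSpace ℝ B] [NormedAddCommGroup G] [NormedSpace ℝ G]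
    {s : Set A} {t : Set B} {f : A → B → G} {j : ℕ}
    (hf : ContDiffOn ℝ ((j + 1 : ℕ) : WithTop ℕ∞) (Function.uncurry f) (s ×ˢ t))
    (ht : UniqueDiffOn ℝ t) :
    ContDiffOn ℝ j (fun p : A × B => fderivWithin ℝ (f p.1) t p.2) (s ×ˢ t) := by
  rintro ⟨a, b⟩ hab
  refine ContDiffWithinAt.fderivWithin (f := fun (p : A × B) y => f p.1 y) (g := Prod.snd)
    (n := ((j + 1 : ℕ) : WithTop ℕ∞)) ?_ contDiff_snd.contDiffWithinAt ht (by simp) hab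
    (fun p hp => hp.2)
  have h := hf (a, b) hab
  exact h.comp (((a, b), b) : (A × B) × B)
    (g := Function.uncurry f) (f := fun q : (A × B) × B => (q.1.1, q.2))
    (by fun_prop) (fun q hq => ⟨hq.1.1, hq.2⟩)

/-- The partial derivative in the first variable of a `C^(j+1)` function on a product. -/
theorem contDiffOn_fderivWithin_left {A B G : Type*} [NormedAddCommGroup A] [NormedSpace ℝ A]
    [NormedAddCommGroup B] [NormedSpace ℝ B] [NormedAddCommGroup G] [NormedSpace ℝ G]
    {s : Set A} {t : Set B} {f : B → A → G} {j : ℕ}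
    (hf : ContDiffOn ℝ ((j + 1 : ℕ) : WithTop ℕ∞) (Function.uncurry f) (t ×ˢ s))
    (ht : UniqueDiffOn ℝ t) :
    ContDiffOn ℝ j (fun p : B × A => fderivWithin ℝ (fun y => f y p.2) t p.1) (t ×ˢ s) := by
  have h1 : ContDiffOn ℝ ((j + 1 : ℕ) : WithTop ℕ∞)
      (Function.uncurry fun a b => f b a) (s ×ˢ t) :=
    hf.comp (f := fun p : A × B => (p.2, p.1)) (by fun_prop) (fun p hp => ⟨hp.2, hp.1⟩)
  exact (contDiffOn_fderivWithin_right h1 ht).comp (f := fun p : B × A => (p.2, p.1))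
    (by fun_prop) (fun p hp => ⟨hp.2, hp.1⟩)

theorem ContDiffOn.slice_right {A B G : Type*} [NormedAddCommGroup A] [NormedSpace ℝ A]
    [NormedAddCommGroup B] [NormedSpace ℝ B] [NormedAddCommGroup G] [NormedSpace ℝ G]
    {s : Set A} {t : Set B} {f : A → B → G} {r : WithTop ℕ∞}
    (hf : ContDiffOn ℝ r (Function.uncurry f) (s ×ˢ t)) {a : A} (ha : a ∈ s) :
    ContDiffOn ℝ r (f a) t :=
  hf.comp (f := fun y => (a, y)) (by fun_prop) (fun _ hy => ⟨ha, hy⟩)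

theorem ContDiffOn.slice_left {A B G : Type*} [NormedAddCommGroup A] [NormedSpace ℝ A]
    [NormedAddCommGroup B] [NormedSpace ℝ B] [NormedAddCommGroup G] [NormedSpace ℝ G]
    {s : Set A} {t : Set B} {f : A → B → G} {r : WithTop ℕ∞}
    (hf : ContDiffOn ℝ r (Function.uncurry f) (s ×ˢ t)) {b : B} (hb : b ∈ t) :
    ContDiffOn ℝ r (fun x => f x b) s :=
  hf.comp (f := fun x => (x, b)) (by fun_prop) (fun _ hx => ⟨hx, hb⟩)

theorem ae_mem_of_compl_null {Z : Type*} [MeasurableSpace Z] {ν : Measure Z} {M : Set Z}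
    (h : ν Mᶜ = 0) : ∀ᵐ z ∂ν, z ∈ M := h

theorem integrable_of_continuousOn_compact {Z G : Type*} [TopologicalSpace Z] [T2Space Z]
    [MeasurableSpace Z] [OpensMeasurableSpace Z] [NormedAddCommGroup G]
    [SecondCountableTopologyEither Z G] {ν : Measure Z}
    [IsFiniteMeasure ν] {M : Set Z} (hM : IsCompact M) (hν : ν Mᶜ = 0) {f : Z → G}
    (hf : ContinuousOn f M) : Integrable f ν := by
  have h1 : ν.restrict M = ν := Measure.restrict_eq_self_of_ae_mem (ae_mem_of_compl_null hν)
  rw [← h1]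
  exact hf.integrableOn_compact' hM hM.measurableSet

/-- Parametric integrals of continuous functions on a product of compact sets are continuous. -/
theorem continuousOn_integral_param {A Z G : Type*} [TopologicalSpace A]
    [FirstCountableTopology A] [TopologicalSpace Z] [T2Space Z]
    [MeasurableSpace Z] [OpensMeasurableSpace Z] [NormedAddCommGroup G] [NormedSpace ℝ G]
    [SecondCountableTopologyEither Z G] {ν : Measure Z}
    [IsFiniteMeasure ν] {L : Set A} {M : Set Z} (hL : IsCompact L) (hM : IsCompact M)
    (hν : ν Mᶜ = 0) {f : A → Z → G} (hf : ContinuousOn (Function.uncurry f) (L ×ˢ M)) :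
    ContinuousOn (fun a => ∫ z, f a z ∂ν) L := by
  obtain ⟨C, hC⟩ := (hL.prod hM).exists_bound_of_continuousOn hf
  intro a ha
  refine continuousWithinAt_of_dominated (bound := fun _ => C) ?_ ?_ (integrable_const C) ?_
  · filter_upwards [self_mem_nhdsWithin] with b hb
    exact (integrable_of_continuousOn_compact hM hν
      (hf.comp (f := fun z => (b, z)) (by fun_prop) (fun z hz => ⟨hb, hz⟩))).1
  · filter_upwards [self_mem_nhdsWithin] with b hb
    filter_upwards [ae_mem_of_compl_null hν] with z hz
    exact hC (b, z) ⟨hb, hz⟩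
  · filter_upwards [ae_mem_of_compl_null hν] with z hz
    exact (hf.comp (f := fun b => (b, z)) (by fun_prop) (fun b hb => ⟨hb, hz⟩)) a ha

/-- Differentiation under the integral sign, up to the boundary of a compact convex set. -/
theorem hasFDerivWithinAt_integral_param {A Z G : Type*} [NormedAddCommGroup A]
    [NormedSpace ℝ A] [NormedAddCommGroup Z] [NormedSpace ℝ Z] [MeasurableSpace Z] [BorelSpace Z]
    [SecondCountableTopology Z]
    [NormedAddCommGroup G] [NormedSpace ℝ G] [CompleteSpace G]
    {ν : Measure Z} [IsFiniteMeasure ν]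
    {L : Set A} {M : Set Z} (hL : IsCompact L) (hLc : Convex ℝ L) (hLu : UniqueDiffOn ℝ L)
    (hM : IsCompact M) (hν : ν Mᶜ = 0) {f : A → Z → G}
    (hf : ContDiffOn ℝ 1 (Function.uncurry f) (L ×ˢ M)) {a : A} (ha : a ∈ L) :
    HasFDerivWithinAt (fun a => ∫ z, f a z ∂ν)
      (∫ z, fderivWithin ℝ (fun a => f a z) L a ∂ν) L a := by
  have hD : ContinuousOn (fun p : A × Z => fderivWithin ℝ (fun y => f y p.2) L p.1) (L ×ˢ M) :=
    (contDiffOn_fderivWithin_left (j := 0) (by simpa using hf) hLu).continuousOn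
  have hDu := (hL.prod hM).uniformContinuousOn_of_continuous hD
  have hint : ∀ b ∈ L, Integrable (f b) ν := fun b hb =>
    integrable_of_continuousOn_compact hM hν
      (hf.continuousOn.comp (f := fun z => (b, z)) (by fun_prop) (fun z hz => ⟨hb, hz⟩))
  have hintD : Integrable (fun z => fderivWithin ℝ (fun a => f a z) L a) ν :=
    integrable_of_continuousOn_compact hM hν
      (hD.comp (f := fun z => (a, z)) (by fun_prop) (fun z hz => ⟨ha, hz⟩))
  rw [hasFDerivWithinAt_iff_isLittleO, Asymptotics.isLittleO_iff]
  intro ε hε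
  set m := ν.real univ with hm
  have hm0 : 0 ≤ m := measureReal_nonneg
  -- Compactness makes `δ` independent of `z`; `m + 1` avoids dividing by a zero total mass.
  obtain ⟨δ, hδ, hδD⟩ := Metric.uniformContinuousOn_iff.1 hDu (ε / (m + 1)) (by positivity)
  have hball : ∀ᶠ b in 𝓝[L] a, b ∈ Metric.ball a δ :=
    mem_nhdsWithin_of_mem_nhds (Metric.ball_mem_nhds a hδ)
  filter_upwards [hball, self_mem_nhdsWithin] with b hb hbL
  have key : ∀ z ∈ M, ‖f b z - f a z - fderivWithin ℝ (fun a => f a z) L a (b - a)‖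
      ≤ ε / (m + 1) * ‖b - a‖ := by
    intro z hz
    refine Convex.norm_image_sub_le_of_norm_hasFDerivWithin_le' (s := L ∩ Metric.ball a δ)
      (f := fun a => f a z) (f' := fun y => fderivWithin ℝ (fun a => f a z) L y) ?_ ?_
      (hLc.inter (convex_ball a δ)) ⟨ha, Metric.mem_ball_self hδ⟩ ⟨hbL, hb⟩
    · intro y hy
      exact ((((hf.slice_left hz).differentiableOn (by simp)) y
        hy.1).hasFDerivWithinAt).mono inter_subset_left
    · intro y hy
      rw [← dist_eq_norm]
      refine (hδD (y, z) ⟨hy.1, hz⟩ (a, z) ⟨ha, hz⟩ ?_).le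
      rw [Prod.dist_eq, dist_self]
      exact max_lt hy.2 hδ
  have e1 : ∫ z, f b z ∂ν - ∫ z, f a z ∂ν
      - (∫ z, fderivWithin ℝ (fun a => f a z) L a ∂ν) (b - a)
      = ∫ z, (f b z - f a z - fderivWithin ℝ (fun a => f a z) L a (b - a)) ∂ν := by
    have happ := hintD.apply_continuousLinearMap (b - a)
    have e2 := integral_sub ((hint b hbL).sub (hint a ha)) happ
    simp only [Pi.sub_apply] at e2
    rw [e2, integral_sub (hint b hbL) (hint a ha), ContinuousLinearMap.integral_apply hintD]
  rw [e1]
  refine (norm_integral_le_of_norm_le_const (C := ε / (m + 1) * ‖b - a‖) ?_).trans ?_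
  · filter_upwards [ae_mem_of_compl_null hν] with z hz using key z hz
  · rw [← hm]
    have : ε / (m + 1) * m ≤ ε := by
      rw [div_mul_eq_mul_div, div_le_iff₀ (by positivity)]; nlinarith
    calc _ = (ε / (m + 1) * m) * ‖b - a‖ := by ring
      _ ≤ _ := by gcongr

/-- The induction replaces the target `G` by `A →L[ℝ] G`. Hence `G` is quantified after `j`, and all
types share one universe. -/
theorem contDiffOn_integral_param {A Z : Type} [NormedAddCommGroup A]
    [NormedSpace ℝ A] [NormedAddCommGroup Z] [NormedSpace ℝ Z] [MeasurableSpace Z] [BorelSpace Z]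
    [SecondCountableTopology Z] {ν : Measure Z} [IsFiniteMeasure ν]
    {L : Set A} {M : Set Z} (hL : IsCompact L) (hLc : Convex ℝ L) (hLu : UniqueDiffOn ℝ L)
    (hM : IsCompact M) (hν : ν Mᶜ = 0) (j : ℕ) :
    ∀ {G : Type} [NormedAddCommGroup G] [NormedSpace ℝ G] [CompleteSpace G] {f : A → Z → G},
    ContDiffOn ℝ j (Function.uncurry f) (L ×ˢ M) →
    ContDiffOn ℝ j (fun a => ∫ z, f a z ∂ν) L := by
  induction j with
  | zero =>
    intro G _ _ _ f hf
    rw [Nat.cast_zero, contDiffOn_zero] at hf ⊢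
    exact continuousOn_integral_param hL hM hν hf
  | succ j ih =>
    intro G _ _ _ f hf
    have h1 := hf.of_le (m := 1) (by norm_cast; omega)
    have hd : ∀ a ∈ L, HasFDerivWithinAt (fun a => ∫ z, f a z ∂ν)
      (∫ z, fderivWithin ℝ (fun a => f a z) L a ∂ν) L a := fun a ha =>
        hasFDerivWithinAt_integral_param hL hLc hLu hM hν h1 ha
    rw [Nat.cast_succ, contDiffOn_succ_iff_fderivWithin hLu]
    refine ⟨fun a ha => (hd a ha).differentiableWithinAt, by simp, ?_⟩
    refine (ih (f := fun a z => fderivWithin ℝ (fun y => f y z) L a)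
      (contDiffOn_fderivWithin_left hf hLu)).congr fun a ha => ?_
    exact (hd a ha).fderivWithin (hLu a ha)

end ParametricCalculus

/-! ### Uniformly convex families: growth, unique minimizers, smooth dependence. -/

section StronglyConvexFamily
open Set Filter Topology

/-- A `C²` family `H x`, `x ∈ K`, of uniformly convex functions on a compact convex set `L`, whose
minima are critical points. -/
structure StronglyConvexFamily {E F : Type*} [NormedAddCommGroup E] [NormedSpace ℝ E]
    [NormedAddCommGroup F] [NormedSpace ℝ F] (K : Set E) (L : Set F) (H : E → F → ℝ)
    (C : ℝ) : Prop where
  pos : 0 < C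
  compact_left : IsCompact K
  compact_right : IsCompact L
  convex : Convex ℝ L
  nonempty : L.Nonempty
  uniqueDiff : UniqueDiffOn ℝ L
  subset_closure : L ⊆ closure (interior L)
  smooth : ContDiffOn ℝ (2 : ℕ) (Function.uncurry H) (K ×ˢ L)
  mono : ∀ x ∈ K, ∀ y ∈ L, ∀ y' ∈ L, C * ‖y' - y‖ ^ 2 ≤
    fderivWithin ℝ (H x) L y' (y' - y) - fderivWithin ℝ (H x) L y (y' - y)
  crit : ∀ x ∈ K, ∀ y ∈ L, IsMinOn (H x) L y → fderivWithin ℝ (H x) L y = 0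

/-- The derivative of an implicitly defined function on an arbitrary set. -/
theorem hasFDerivWithinAt_of_implicit {E F F' : Type*} [NormedAddCommGroup E] [NormedSpace ℝ E]
    [NormedAddCommGroup F] [NormedSpace ℝ F] [NormedAddCommGroup F'] [NormedSpace ℝ F']
    {K : Set E} {L : Set F} {G : E × F → F'} {T : E → F} {x : E} {D : E × F →L[ℝ] F'}
    (hG : HasFDerivWithinAt G D (K ×ˢ L) (x, T x)) (e : F ≃L[ℝ] F')
    (he : (e : F →L[ℝ] F') = D.comp (ContinuousLinearMap.inr ℝ E F)) (hT : MapsTo T K L)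
    (hc : ContinuousWithinAt T K x) (hx : x ∈ K) (h0 : ∀ x ∈ K, G (x, T x) = 0) :
    HasFDerivWithinAt T (-((e.symm : F' →L[ℝ] F).comp
      (D.comp (ContinuousLinearMap.inl ℝ E F)))) K x := by
  -- Reduction to an inverse function: `(x, y) ↦ (x, G (x, y))` has this triangular, invertible
  -- derivative, and it undoes `(x, 0) ↦ (x, T x)`.
  set e2 : (E × F) ≃L[ℝ] (E × F') := ContinuousLinearEquiv.skewProd
    (ContinuousLinearEquiv.refl ℝ E) e (D.comp (ContinuousLinearMap.inl ℝ E F)) with he2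
  have hD : ∀ v : E × F, D v = e v.2 + D (v.1, 0) := by
    intro v
    have := congrArg (fun f => f v.2) he
    simp only [ContinuousLinearEquiv.coe_coe, ContinuousLinearMap.comp_apply,
      ContinuousLinearMap.inr_apply] at this
    rw [this, ← map_add]
    simp
  have h1 : HasFDerivWithinAt (fun p : E × F => (p.1, G p)) (e2 : (E × F) →L[ℝ] (E × F'))
      (K ×ˢ L) (x, T x) := by
    have h2 : (e2 : (E × F) →L[ℝ] (E × F')) = (ContinuousLinearMap.fst ℝ E F).prod D := by
      refine ContinuousLinearMap.ext fun v => ?_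
      simp [he2, hD v]
    rw [h2]
    exact hasFDerivWithinAt_fst.prodMk hG
  have h3 := HasFDerivWithinAt.of_local_left_inverse (f := fun p : E × F => (p.1, G p))
    (g := fun q : E × F' => (q.1, T q.1)) (s := K ×ˢ ({0} : Set F')) (t := K ×ˢ L)
    (a := (x, 0)) (f' := e2) ?_ h1 ⟨hx, rfl⟩ ?_
  · have h4 : HasFDerivWithinAt (fun x : E => ((x, 0) : E × F'))
        (ContinuousLinearMap.inl ℝ E F') K x :=
      (ContinuousLinearMap.inl ℝ E F').hasFDerivWithinAt
    have h5 := (h3.comp x h4 (show MapsTo _ K (K ×ˢ {0}) from fun y hy => ⟨hy, rfl⟩)).snd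
    refine h5.congr_fderiv (ContinuousLinearMap.ext fun v => ?_)
    have h7 : e2.symm (v, 0) = (v, -(e.symm (D (v, 0)))) := by
      refine e2.symm_apply_eq.2 ?_
      simp [he2]
    simp [h7]
  · have hc2 : ContinuousWithinAt (fun q : E × F' => (q.1, T q.1)) (K ×ˢ ({0} : Set F')) (x, 0) :=
      continuousWithinAt_fst.prodMk
        (ContinuousWithinAt.comp (t := K) (f := Prod.fst) (g := T) hc continuousWithinAt_fst
          (fun q hq => hq.1))
    exact hc2.tendsto_nhdsWithin (fun q hq => ⟨hq.1, hT hq.1⟩)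
  · filter_upwards [self_mem_nhdsWithin] with q hq
    rw [h0 q.1 hq.1]
    exact Prod.ext rfl hq.2.symm

namespace StronglyConvexFamily

variable {E F : Type*} [NormedAddCommGroup E] [NormedSpace ℝ E]
    [NormedAddCommGroup F] [NormedSpace ℝ F] {K : Set E} {L : Set F} {H : E → F → ℝ}
    {C : ℝ}

theorem contDiffOn_deriv (h : StronglyConvexFamily K L H C) {k : ℕ}
    (hk : ContDiffOn ℝ ((k + 1 : ℕ) : WithTop ℕ∞) (Function.uncurry H) (K ×ˢ L)) :
    ContDiffOn ℝ k (fun p : E × F => fderivWithin ℝ (H p.1) L p.2) (K ×ˢ L) :=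
  contDiffOn_fderivWithin_right hk h.uniqueDiff

theorem continuousOn_deriv (h : StronglyConvexFamily K L H C) :
    ContinuousOn (fun p : E × F => fderivWithin ℝ (H p.1) L p.2) (K ×ˢ L) :=
  (h.contDiffOn_deriv h.smooth).continuousOn

theorem hasFDerivWithinAt (h : StronglyConvexFamily K L H C) {x : E} (hx : x ∈ K) {y : F}
    (hy : y ∈ L) : HasFDerivWithinAt (H x) (fderivWithin ℝ (H x) L y) L y :=
  ((h.smooth.slice_right hx).differentiableOn (by simp) y hy).hasFDerivWithinAt

/-- Quadratic growth of a uniformly convex function above its tangents. -/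
theorem growth (h : StronglyConvexFamily K L H C) {x : E} (hx : x ∈ K) {y y' : F}
    (hy : y ∈ L) (hy' : y' ∈ L) :
    H x y + fderivWithin ℝ (H x) L y (y' - y) + C / 2 * ‖y' - y‖ ^ 2 ≤ H x y' := by
  set v := y' - y with hv
  have hmem : ∀ t ∈ Icc (0 : ℝ) 1, y + t • v ∈ L := fun t ht => by
    have := h.convex.add_smul_sub_mem hy hy' ht
    simpa [hv] using this
  -- With the tangent and the parabola removed along the segment, `t * g' t ≥ 0` is `mono` for the
  -- points `y` and `y + t • v`.
  set g : ℝ → ℝ := fun t => H x (y + t • v) - t * fderivWithin ℝ (H x) L y v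
    - C / 2 * ‖v‖ ^ 2 * t ^ 2 with hg
  have hd : ∀ t ∈ Icc (0 : ℝ) 1, HasDerivWithinAt g (fderivWithin ℝ (H x) L (y + t • v) v
      - fderivWithin ℝ (H x) L y v - C * ‖v‖ ^ 2 * t) (Icc 0 1) t := by
    intro t ht
    have h1 : HasDerivWithinAt (fun t : ℝ => y + t • v) v (Icc 0 1) t := by
      simpa using (((hasDerivAt_id t).smul_const v).const_add y).hasDerivWithinAt
    have h2 := (h.hasFDerivWithinAt hx (hmem t ht)).comp_hasDerivWithinAt t h1 hmem
    have h3 : HasDerivWithinAt (fun t : ℝ => t * fderivWithin ℝ (H x) L y v)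
        (fderivWithin ℝ (H x) L y v) (Icc 0 1) t := by
      simpa using ((hasDerivAt_id t).mul_const (fderivWithin ℝ (H x) L y v)).hasDerivWithinAt
    have h4 : HasDerivWithinAt (fun t : ℝ => C / 2 * ‖v‖ ^ 2 * t ^ 2)
        (C * ‖v‖ ^ 2 * t) (Icc 0 1) t := by
      have := ((hasDerivAt_pow 2 t).const_mul (C / 2 * ‖v‖ ^ 2)).hasDerivWithinAt (s := Icc 0 1)
      exact this.congr_deriv (by push_cast; ring)
    exact (h2.sub h3).sub h4
  have hmono : MonotoneOn g (Icc 0 1) := by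
    refine monotoneOn_of_hasDerivWithinAt_nonneg (convex_Icc 0 1)
      (fun t ht => (hd t ht).continuousWithinAt)
      (fun t ht => (hd t (interior_subset ht)).mono interior_subset) ?_
    intro t ht
    rw [interior_Icc] at ht
    have h1 := h.mono x hx y hy _ (hmem t ⟨ht.1.le, ht.2.le⟩)
    simp only [add_sub_cancel_left, map_smul, smul_eq_mul, norm_smul, Real.norm_eq_abs,
      abs_of_pos ht.1] at h1
    have h2 : 0 ≤ t * (fderivWithin ℝ (H x) L (y + t • v) v
      - fderivWithin ℝ (H x) L y v - C * ‖v‖ ^ 2 * t) := by nlinarith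
    exact nonneg_of_mul_nonneg_right h2 ht.1
  have := hmono (left_mem_Icc.2 zero_le_one) (right_mem_Icc.2 zero_le_one) zero_le_one
  simp only [hg, zero_smul, add_zero, one_smul] at this
  rw [hv, add_sub_cancel, ← hv] at this
  linarith

theorem exists_argmin (h : StronglyConvexFamily K L H C) :
    ∃ T : E → F, MapsTo T K L ∧ ∀ x ∈ K, fderivWithin ℝ (H x) L (T x) = 0 := by
  have : ∀ x, ∃ y, x ∈ K → y ∈ L ∧ fderivWithin ℝ (H x) L y = 0 := by
    intro x
    by_cases hx : x ∈ K
    · obtain ⟨y, hy, hm⟩ := h.compact_right.exists_isMinOn h.nonempty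
        (h.smooth.slice_right hx).continuousOn
      exact ⟨y, fun _ => ⟨hy, h.crit x hx y hy hm⟩⟩
    · exact ⟨0, fun h => (hx h).elim⟩
  choose T hT using this
  exact ⟨T, fun x hx => (hT x hx).1, fun x hx => (hT x hx).2⟩

theorem growth_argmin (h : StronglyConvexFamily K L H C) {x : E} (hx : x ∈ K) {y y' : F}
    (hy : y ∈ L) (h0 : fderivWithin ℝ (H x) L y = 0) (hy' : y' ∈ L) :
    H x y + C / 2 * ‖y' - y‖ ^ 2 ≤ H x y' := by
  simpa [h0] using h.growth hx hy hy'

/-- Strong monotonicity of the derivative of `H x'` between `T x` and `T x'`, where it vanishes at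
`T x'`, gives `C ‖T x' - T x‖ ≤ ‖D(H x')(T x)‖`. The right side tends to `‖D(H x)(T x)‖ = 0` as `x'
→ x`. -/
theorem continuousOn_argmin (h : StronglyConvexFamily K L H C) {T : E → F} (hT : MapsTo T K L)
    (h0 : ∀ x ∈ K, fderivWithin ℝ (H x) L (T x) = 0) : ContinuousOn T K := by
  intro x hx
  have h1 : ∀ x' ∈ K, C * ‖T x' - T x‖ ≤ ‖fderivWithin ℝ (H x') L (T x)‖ := by
    intro x' hx'
    have h2 := h.mono x' hx' _ (hT hx) _ (hT hx')
    rw [h0 x' hx', zero_apply, zero_sub] at h2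
    have h3 : C * ‖T x' - T x‖ ^ 2 ≤ ‖fderivWithin ℝ (H x') L (T x)‖ * ‖T x' - T x‖ := by
      refine h2.trans ((le_abs_self _).trans ?_)
      rw [abs_neg]
      exact (fderivWithin ℝ (H x') L (T x)).le_opNorm _
    rcases (norm_nonneg (T x' - T x)).eq_or_lt with h4 | h4
    · rw [← h4]; simp
    · refine le_of_mul_le_mul_right ?_ h4
      nlinarith
  have h2 : Tendsto (fun x' => ‖fderivWithin ℝ (H x') L (T x)‖) (𝓝[K] x) (𝓝 0) := by
    have := ((h.continuousOn_deriv.comp (f := fun x' => (x', T x)) (by fun_prop)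
      (fun x' hx' => ⟨hx', hT hx⟩)) x hx).norm.tendsto
    simpa [h0 x hx] using this
  rw [ContinuousWithinAt, tendsto_iff_norm_sub_tendsto_zero]
  have h3 : Tendsto (fun x' => C⁻¹ * ‖fderivWithin ℝ (H x') L (T x)‖) (𝓝[K] x) (𝓝 0) := by
    simpa using h2.const_mul C⁻¹
  refine squeeze_zero' (Eventually.of_forall fun _ => norm_nonneg _) ?_ h3
  filter_upwards [self_mem_nhdsWithin] with x' hx'
  rw [inv_mul_eq_div, le_div_iff₀ h.pos, mul_comm]
  exact h1 x' hx'

/-- At interior points this is `mono` on `y` and `y + t • v`, divided by `t²`, as `t → 0⁺`. Boundary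
points follow from continuity of the second derivative and `subset_closure`. -/
theorem coercive (h : StronglyConvexFamily K L H C) {x : E} (hx : x ∈ K) {y : F} (hy : y ∈ L)
    (v : F) : C * ‖v‖ ^ 2 ≤ fderivWithin ℝ (fun y => fderivWithin ℝ (H x) L y) L y v v := by
  have hG : ContDiffOn ℝ ((0 + 1 : ℕ) : WithTop ℕ∞) (fun y => fderivWithin ℝ (H x) L y) L :=
    (contDiffOn_deriv h (k := 1) h.smooth).slice_right (f := fun x y => fderivWithin ℝ (H x) L y)
      hx
  have hc : ContinuousOn
      (fun y => fderivWithin ℝ (fun y => fderivWithin ℝ (H x) L y) L y v v) L := by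
    have := hG.continuousOn_fderivWithin h.uniqueDiff (by simp)
    exact (this.clm_apply continuousOn_const).clm_apply continuousOn_const
  refine ContinuousWithinAt.closure_le (s := interior L) (h.subset_closure hy)
    continuousWithinAt_const ((hc y hy).mono interior_subset) ?_
  intro z hz
  have hzL : L ∈ 𝓝 z := mem_interior_iff_mem_nhds.1 hz
  have hd := ((hG.differentiableOn (by simp) z
    (interior_subset hz)).hasFDerivWithinAt).hasFDerivAt hzL
  have h1 : HasDerivAt (fun t : ℝ => z + t • v) v 0 := by
    simpa using ((hasDerivAt_id (0 : ℝ)).smul_const v).const_add z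
  have h2 : HasDerivAt (fun t : ℝ => fderivWithin ℝ (H x) L (z + t • v) v)
      (fderivWithin ℝ (fun y => fderivWithin ℝ (H x) L y) L z v v) 0 := by
    have h3 := HasFDerivAt.comp_hasDerivAt_of_eq (0 : ℝ) hd h1 (by simp)
    simpa using h3.clm_apply (hasDerivAt_const 0 v)
  have h4 := h2.tendsto_slope_zero_right
  refine ge_of_tendsto h4 ?_
  have h5 : ∀ᶠ t : ℝ in 𝓝[>] 0, z + t • v ∈ L :=
    (h1.continuousAt.eventually_mem (by simpa using hzL)).filter_mono nhdsWithin_le_nhds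
  filter_upwards [h5, self_mem_nhdsWithin] with t ht ht0
  have ht0 : 0 < t := ht0
  have h6 := h.mono x hx z (interior_subset hz) _ ht
  simp only [add_sub_cancel_left, map_smul, smul_eq_mul, norm_smul, Real.norm_eq_abs,
      abs_of_pos ht0] at h6
  simp only [zero_add, zero_smul, add_zero, smul_eq_mul]
  rw [inv_mul_eq_div, le_div_iff₀ ht0]
  refine le_of_mul_le_mul_left ?_ ht0
  nlinarith

/-- Coercivity makes the Hessian injective, and a finite-dimensional space and its dual have equal
dimension. -/
theorem exists_hessian_equiv [FiniteDimensional ℝ F] (h : StronglyConvexFamily K L H C) {x : E}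
    (hx : x ∈ K) {y : F} (hy : y ∈ L) : ∃ e : F ≃L[ℝ] (F →L[ℝ] ℝ), (e : F →L[ℝ] (F →L[ℝ] ℝ)) =
      fderivWithin ℝ (fun y => fderivWithin ℝ (H x) L y) L y := by
  set A := fderivWithin ℝ (fun y => fderivWithin ℝ (H x) L y) L y with hA
  have hinj : Function.Injective (A : F →ₗ[ℝ] (F →L[ℝ] ℝ)) := by
    rw [← LinearMap.ker_eq_bot, LinearMap.ker_eq_bot']
    intro v hv
    have h1 := h.coercive hx hy v
    have h2 : A v = 0 := hv
    rw [← hA, h2, zero_apply] at h1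
    by_contra hne
    have := norm_pos_iff.2 hne
    have := h.pos
    have : 0 < C * ‖v‖ ^ 2 := by positivity
    linarith
  have hdim : Module.finrank ℝ F = Module.finrank ℝ (F →L[ℝ] ℝ) := by
    rw [← (LinearMap.toContinuousLinearMap (𝕜 := ℝ) (E := F) (F' := ℝ)).finrank_eq]
    exact (Subspace.dual_finrank_eq (K := ℝ) (V := F)).symm
  refine ⟨(LinearMap.linearEquivOfInjective _ hinj hdim).toContinuousLinearEquiv, ?_⟩
  ext v
  rfl

/-- The minimizer of `H x` depends smoothly on `x`. -/
theorem contDiffOn_argmin [FiniteDimensional ℝ F] (h : StronglyConvexFamily K L H C) {T : E → F}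
    (hT : MapsTo T K L) (h0 : ∀ x ∈ K, fderivWithin ℝ (H x) L (T x) = 0) {k : ℕ}
    (hk : ContDiffOn ℝ ((k + 1 : ℕ) : WithTop ℕ∞) (Function.uncurry H) (K ×ˢ L)) :
    ContDiffOn ℝ k T K := by
  have hc := h.continuousOn_argmin hT h0
  have hG := h.contDiffOn_deriv hk
  -- Bootstrap: the derivative of `T` is an expression in the derivatives of the gradient at `(x, T
  -- x)`, so it is `C^j` once `T` is.
  suffices ∀ j : ℕ, j ≤ k → ContDiffOn ℝ j T K from this k le_rfl
  intro j
  induction j with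
  | zero => intro _; simpa using hc
  | succ j ih =>
    intro hj
    have ihj := ih (by omega)
    intro x hx
    have hG1 : ContDiffWithinAt ℝ ((j : WithTop ℕ∞) + 1)
        (fun p : E × F => fderivWithin ℝ (H p.1) L p.2) (K ×ˢ L) (x, T x) :=
      (hG.of_le (by exact_mod_cast hj)) _ ⟨hx, hT hx⟩
    -- Derivatives within `K` need not be unique, so a chosen smooth family `D` of derivatives is
    -- used instead of `fderivWithin` on the product.
    rw [contDiffWithinAt_succ_iff_hasFDerivWithinAt' (by simp)] at hG1
    obtain ⟨u, hu, -, -, D, hD, hDc⟩ := hG1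
    rw [insert_eq_of_mem (show (x, T x) ∈ K ×ˢ L from ⟨hx, hT hx⟩)] at hu
    have hpair : ContinuousWithinAt (fun x => (x, T x)) K x :=
      continuousWithinAt_id.prodMk (hc x hx)
    have hpre : (fun x => (x, T x)) ⁻¹' u ∈ 𝓝[K] x :=
      hpair.tendsto_nhdsWithin (show MapsTo _ K (K ×ˢ L) from fun z hz => ⟨hz, hT hz⟩) hu
    -- Derivatives within `L` are unique, so whatever the choice of `D`, its `y`-part is the Hessian
    -- and therefore invertible.
    have hinr : ∀ z ∈ K, (z, T z) ∈ u →
        fderivWithin ℝ (fun y => fderivWithin ℝ (H z) L y) L (T z) =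
        (D (z, T z)).comp (ContinuousLinearMap.inr ℝ E F) := by
      intro z hz hzu
      have h1 : HasFDerivWithinAt (fun y : F => (z, y)) (ContinuousLinearMap.inr ℝ E F) L (T z) :=
        (hasFDerivAt_prodMk_right z (T z)).hasFDerivWithinAt
      exact ((hD _ hzu).comp (T z) h1
        (show MapsTo _ L (K ×ˢ L) from fun y hy => ⟨hz, hy⟩)).fderivWithin
        (h.uniqueDiff _ (hT hz))
    rw [Nat.cast_succ, contDiffWithinAt_succ_iff_hasFDerivWithinAt' (by simp), insert_eq_of_mem hx]
    refine ⟨K ∩ (fun x => (x, T x)) ⁻¹' u, inter_mem self_mem_nhdsWithin hpre, inter_subset_left,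
      by simp, fun z => -((ContinuousLinearMap.inverse
        ((D (z, T z)).comp (ContinuousLinearMap.inr ℝ E F))).comp
        ((D (z, T z)).comp (ContinuousLinearMap.inl ℝ E F))), ?_, ?_⟩
    · rintro z ⟨hz, hzu⟩
      obtain ⟨e, he⟩ := h.exists_hessian_equiv hz (hT hz)
      rw [hinr z hz hzu] at he
      beta_reduce
      rw [← he, ContinuousLinearMap.inverse_equiv]
      exact hasFDerivWithinAt_of_implicit (hD _ hzu) e he hT (hc z hz) hz h0
    · have hx_u : (x, T x) ∈ u := mem_of_mem_nhdsWithin (show (x, T x) ∈ K ×ˢ L from ⟨hx, hT hx⟩) hu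
      obtain ⟨e, he⟩ := h.exists_hessian_equiv hx (hT hx)
      rw [hinr x hx hx_u] at he
      have hDT : ContDiffWithinAt ℝ j (fun z => D (z, T z)) K x :=
        hDc.comp (f := fun z => (z, T z)) x (contDiffWithinAt_id.prodMk (ihj x hx))
          (show MapsTo _ K (K ×ˢ L) from fun z hz => ⟨hz, hT hz⟩)
      have h1 : ContDiffWithinAt ℝ j
          (fun z => (D (z, T z)).comp (ContinuousLinearMap.inr ℝ E F)) K x :=
        hDT.clm_comp contDiffWithinAt_const
      have h2 : ContDiffWithinAt ℝ j
          (fun z => (D (z, T z)).comp (ContinuousLinearMap.inl ℝ E F)) K x :=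
        hDT.clm_comp contDiffWithinAt_const
      have h3 : ContDiffAt ℝ j ContinuousLinearMap.inverse
          ((D (x, T x)).comp (ContinuousLinearMap.inr ℝ E F)) := by
        rw [← he]; exact contDiffAt_map_inverse e
      exact ((h3.comp_contDiffWithinAt x h1).clm_comp h2).neg

end StronglyConvexFamily
end StronglyConvexFamily

/-! ### From the hypotheses on `c`, `V`, `W` to a uniformly convex family. -/

section Model
open Set Filter Topology

/-- The potential `V + ∫ W(·, z) dν(z)` felt by the mass at equilibrium. -/
noncomputable def meanPotential {F : Type*} [MeasurableSpace F] (V : F → ℝ) (W : F → F → ℝ)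
    (ν : Measure F) (y : F) : ℝ :=
  V y + ∫ z, W y z ∂ν

/-- The cost `c` augmented by the potential of the measure `ν`. -/
noncomputable def totalCost {E F : Type*} [MeasurableSpace F] (c : E → F → ℝ) (V : F → ℝ)
    (W : F → F → ℝ) (ν : Measure F) (x : E) (y : F) : ℝ :=
  c x y + meanPotential V W ν y

/-- Links the Hessian of `UniformConvexity`, built from `fderiv`, with the gradient within `L` used
elsewhere: the two gradients agree near each point of the open set `Y`. -/
theorem hasDerivAt_fderivWithin_line {F : Type*} [NormedAddCommGroup F] [NormedSpace ℝ F]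
    {Y L : Set F} (hY : IsOpen Y) (hYL : Y ⊆ L) {f : F → ℝ} (hf : ContDiffOn ℝ (2 : ℕ) f L)
    (y v : F) {t : ℝ} (ht : y + t • v ∈ Y) :
    HasDerivAt (fun t : ℝ => fderivWithin ℝ f L (y + t • v) v) (secondDeriv f (y + t • v) v) t := by
  have hLn : ∀ z ∈ Y, L ∈ 𝓝 z := fun z hz => mem_of_superset (hY.mem_nhds hz) hYL
  have h1 : ContDiffAt ℝ (1 : ℕ) (fderiv ℝ f) (y + t • v) :=
    (hf.contDiffAt (hLn _ ht)).fderiv_right (by norm_num)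
  have h2 : fderivWithin ℝ f L =ᶠ[𝓝 (y + t • v)] fderiv ℝ f := by
    filter_upwards [hY.mem_nhds ht] with z hz using fderivWithin_of_mem_nhds (hLn z hz)
  have h3 : HasFDerivAt (fderivWithin ℝ f L) (fderiv ℝ (fderiv ℝ f) (y + t • v)) (y + t • v) :=
    (h1.differentiableAt (by simp)).hasFDerivAt.congr_of_eventuallyEq h2
  have h4 : HasDerivAt (fun t : ℝ => y + t • v) v t := by
    simpa using ((hasDerivAt_id t).smul_const v).const_add y
  have h5 := h3.comp_hasDerivAt t h4
  have h6 := h5.clm_apply (hasDerivAt_const t v)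
  rw [map_zero, add_zero] at h6
  exact h6

variable {E F : Type} [NormedAddCommGroup E] [NormedSpace ℝ E]
  [NormedAddCommGroup F] [InnerProductSpace ℝ F]
  {X : Set E} {Y : Set F} {c : E → F → ℝ} {V : F → ℝ} {W : F → F → ℝ}

/-- `UniformConvexity` differentiates `W` in its second slot, `OutwardGradient` in its first;
symmetry reconciles them. -/
theorem fderivWithin_swap_eq {Y : Set F} (hWsymm : ∀ y ∈ closure Y, ∀ z ∈ closure Y, W y z = W z y)
    {y z : F} (hy : y ∈ closure Y) (hz : z ∈ closure Y) :
    fderivWithin ℝ (fun y' => W y' z) (closure Y) y = fderivWithin ℝ (W z) (closure Y) y :=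
  fderivWithin_congr (fun y' hy' => hWsymm y' hy' z hz) (hWsymm y hy z hz)

theorem uniqueDiffOn_closure (hYo : IsOpen Y) (hYc : Convex ℝ Y) (hne : (closure Y).Nonempty) :
    UniqueDiffOn ℝ (closure Y) :=
  uniqueDiffOn_convex hYc.closure
    ((closure_nonempty_iff.1 hne).mono (interior_maximal subset_closure hYo))

/-- The Hessian bound integrated along the segment from `y` to `y'`, which stays in `Y` by
convexity. -/
theorem mono_of_uniformConvexity_interior (hYo : IsOpen Y) (hYc : Convex ℝ Y)
    (hsmooth : SmoothData 2 X Y c V W)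
    (hWsymm : ∀ y ∈ closure Y, ∀ z ∈ closure Y, W y z = W z y) {C : ℝ}
    (hconv : ∀ x ∈ X, ∀ y ∈ Y, ∀ z ∈ Y, ∀ h : F,
      C * ‖h‖ ^ 2 ≤ secondDeriv (c x) y h + secondDeriv V y h + secondDeriv (W z) y h)
    {x : E} (hx : x ∈ X) {y y' z : F} (hy : y ∈ Y) (hy' : y' ∈ Y) (hz : z ∈ Y) :
    C * ‖y' - y‖ ^ 2 ≤
      (fderivWithin ℝ (c x) (closure Y) y' (y' - y) + fderivWithin ℝ V (closure Y) y' (y' - y)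
        + fderivWithin ℝ (fun y' => W y' z) (closure Y) y' (y' - y)) -
      (fderivWithin ℝ (c x) (closure Y) y (y' - y) + fderivWithin ℝ V (closure Y) y (y' - y)
        + fderivWithin ℝ (fun y' => W y' z) (closure Y) y (y' - y)) := by
  have hs := subset_closure (s := Y)
  rw [fderivWithin_swap_eq hWsymm (hs hy) (hs hz), fderivWithin_swap_eq hWsymm (hs hy') (hs hz)]
  set v := y' - y with hv
  have hmem : ∀ t ∈ Icc (0 : ℝ) 1, y + t • v ∈ Y := fun t ht => by
    have := hYc.add_smul_sub_mem hy hy' ht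
    simpa [hv] using this
  set L := closure Y
  set g : ℝ → ℝ := fun t => fderivWithin ℝ (c x) L (y + t • v) v
    + fderivWithin ℝ V L (y + t • v) v + fderivWithin ℝ (W z) L (y + t • v) v
    - t * (C * ‖v‖ ^ 2) with hg
  have hd : ∀ t ∈ Icc (0 : ℝ) 1, HasDerivAt g (secondDeriv (c x) (y + t • v) v
      + secondDeriv V (y + t • v) v + secondDeriv (W z) (y + t • v) v - C * ‖v‖ ^ 2) t := by
    intro t ht
    have h1 := hasDerivAt_fderivWithin_line hYo hs (hsmooth.1.slice_right (subset_closure hx)) y v (hmem t ht)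
    have h2 := hasDerivAt_fderivWithin_line hYo hs hsmooth.2.1 y v (hmem t ht)
    have h3 := hasDerivAt_fderivWithin_line hYo hs (hsmooth.2.2.slice_right (hs hz)) y v
      (hmem t ht)
    have h4 : HasDerivAt (fun t : ℝ => t * (C * ‖v‖ ^ 2)) (C * ‖v‖ ^ 2) t := by
      simpa using (hasDerivAt_id t).mul_const (C * ‖v‖ ^ 2)
    exact ((h1.add h2).add h3).sub h4
  have hmono : MonotoneOn g (Icc 0 1) := by
    refine monotoneOn_of_hasDerivWithinAt_nonneg (convex_Icc 0 1)
      (fun t ht => (hd t ht).continuousAt.continuousWithinAt)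
      (fun t ht => (hd t (interior_subset ht)).hasDerivWithinAt) ?_
    intro t ht
    have := hconv x hx _ (hmem t (interior_subset ht)) z hz v
    linarith
  have := hmono (left_mem_Icc.2 zero_le_one) (right_mem_Icc.2 zero_le_one) zero_le_one
  simp only [hg, zero_smul, add_zero, one_smul] at this
  rw [hv, add_sub_cancel, ← hv] at this
  linarith

/-- This continuity carries both hypotheses from open sets to their closures, as needed because `μ`
and `ν` may charge the boundaries. -/
theorem continuousOn_totalDeriv (hLu : UniqueDiffOn ℝ (closure Y))
    (hsmooth : SmoothData 2 X Y c V W) :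
    ContinuousOn (fun q : E × F × F => fderivWithin ℝ (c q.1) (closure Y) q.2.1
      + fderivWithin ℝ V (closure Y) q.2.1
      + fderivWithin ℝ (fun y' => W y' q.2.2) (closure Y) q.2.1)
      (closure X ×ˢ closure Y ×ˢ closure Y) := by
  have h1 := (contDiffOn_fderivWithin_right (j := 1) hsmooth.1 hLu).continuousOn
  have h2 := hsmooth.2.1.continuousOn_fderivWithin hLu (by simp)
  have h3 := (contDiffOn_fderivWithin_left (j := 1) hsmooth.2.2 hLu).continuousOn
  refine ContinuousOn.add (ContinuousOn.add ?_ ?_) ?_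
  · exact h1.comp (f := fun q : E × F × F => (q.1, q.2.1)) (by fun_prop)
      (fun q hq => ⟨hq.1, hq.2.1⟩)
  · exact h2.comp (f := fun q : E × F × F => q.2.1) (by fun_prop) (fun q hq => hq.2.1)
  · exact h3.comp (f := fun q : E × F × F => (q.2.1, q.2.2)) (by fun_prop)
      (fun q hq => ⟨hq.2.1, hq.2.2⟩)

theorem mono_of_uniformConvexity (hYo : IsOpen Y) (hYc : Convex ℝ Y)
    (hLu : UniqueDiffOn ℝ (closure Y)) (hsmooth : SmoothData 2 X Y c V W)
    (hWsymm : ∀ y ∈ closure Y, ∀ z ∈ closure Y, W y z = W z y) {C : ℝ}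
    (hconv : ∀ x ∈ X, ∀ y ∈ Y, ∀ z ∈ Y, ∀ h : F,
      C * ‖h‖ ^ 2 ≤ secondDeriv (c x) y h + secondDeriv V y h + secondDeriv (W z) y h)
    {x : E} (hx : x ∈ closure X) {y y' z : F} (hy : y ∈ closure Y) (hy' : y' ∈ closure Y)
    (hz : z ∈ closure Y) :
    C * ‖y' - y‖ ^ 2 ≤
      (fderivWithin ℝ (c x) (closure Y) y' (y' - y) + fderivWithin ℝ V (closure Y) y' (y' - y)
        + fderivWithin ℝ (fun y' => W y' z) (closure Y) y' (y' - y)) -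
      (fderivWithin ℝ (c x) (closure Y) y (y' - y) + fderivWithin ℝ V (closure Y) y (y' - y)
        + fderivWithin ℝ (fun y' => W y' z) (closure Y) y (y' - y)) := by
  have hD := continuousOn_totalDeriv hLu hsmooth
  set D := fun q : E × F × F => fderivWithin ℝ (c q.1) (closure Y) q.2.1
      + fderivWithin ℝ V (closure Y) q.2.1
      + fderivWithin ℝ (fun y' => W y' q.2.2) (closure Y) q.2.1 with hDdef
  have hsub : X ×ˢ Y ×ˢ Y ×ˢ Y ⊆ closure X ×ˢ closure Y ×ˢ closure Y ×ˢ closure Y :=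
    prod_mono subset_closure (prod_mono subset_closure (prod_mono subset_closure subset_closure))
  have hq : ((x, y, y', z) : E × F × F × F) ∈ closure X ×ˢ closure Y ×ˢ closure Y ×ˢ closure Y :=
    ⟨hx, hy, hy', hz⟩
  have hc1 : ContinuousOn (fun q : E × F × F × F => D (q.1, q.2.2.1, q.2.2.2) (q.2.2.1 - q.2.1)
      - D (q.1, q.2.1, q.2.2.2) (q.2.2.1 - q.2.1))
      (closure X ×ˢ closure Y ×ˢ closure Y ×ˢ closure Y) := by
    refine ContinuousOn.sub (ContinuousOn.clm_apply ?_ (by fun_prop))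
      (ContinuousOn.clm_apply ?_ (by fun_prop))
    · exact hD.comp (f := fun q : E × F × F × F => (q.1, q.2.2.1, q.2.2.2)) (by fun_prop)
        (fun q hq => ⟨hq.1, hq.2.2.1, hq.2.2.2⟩)
    · exact hD.comp (f := fun q : E × F × F × F => (q.1, q.2.1, q.2.2.2)) (by fun_prop)
        (fun q hq => ⟨hq.1, hq.2.1, hq.2.2.2⟩)
  have key := ContinuousWithinAt.closure_le (s := X ×ˢ Y ×ˢ Y ×ˢ Y) (x := (x, y, y', z))
    (f := fun q : E × F × F × F => C * ‖q.2.2.1 - q.2.1‖ ^ 2) (by simpa [closure_prod_eq] using hq)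
    (by fun_prop) ((hc1 _ hq).mono hsub) (fun q hq => by
      simpa [hDdef] using mono_of_uniformConvexity_interior hYo hYc hsmooth hWsymm hconv hq.1
        hq.2.1 hq.2.2.1 hq.2.2.2)
  simpa [hDdef] using key

/-- Only `x` and `z` are moved to the closure; `y` and the normal `p` stay fixed. -/
theorem outwardGradient_closure (hLu : UniqueDiffOn ℝ (closure Y))
    (hsmooth : SmoothData 2 X Y c V W) (hout : OutwardGradient X Y c V W) {x : E}
    (hx : x ∈ closure X) {y z : F} (hy : y ∈ frontier Y) (hz : z ∈ closure Y) {p : F}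
    (hp : IsOutwardUnitNormal Y y p) :
    0 ≤ fderivWithin ℝ (c x) (closure Y) y p + fderivWithin ℝ V (closure Y) y p
      + fderivWithin ℝ (fun y' => W y' z) (closure Y) y p := by
  have hD := continuousOn_totalDeriv hLu hsmooth
  have hyL : y ∈ closure Y := hy.1
  have hc1 := ((hD.comp (f := fun q : E × F => (q.1, y, q.2)) (s := closure X ×ˢ closure Y)
    (by fun_prop) (fun q hq => ⟨hq.1, hyL, hq.2⟩)).clm_apply (continuousOn_const (c := p)))
    (x, z) ⟨hx, hz⟩
  have key := ContinuousWithinAt.closure_le (s := X ×ˢ Y) (x := (x, z))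
    (f := fun q : E × F => (0 : ℝ)) (by simpa [closure_prod_eq] using ⟨hx, hz⟩)
    continuousWithinAt_const (hc1.mono (prod_mono subset_closure subset_closure))
    (fun q hq => by simpa using hout q.1 hq.1 q.2 hq.2 y hy p hp)
  simpa using key

variable [FiniteDimensional ℝ F] [MeasurableSpace F] [BorelSpace F] {ν : Measure F}

theorem SmoothData.contDiffOn_meanPotential {k : ℕ} (h : SmoothData k X Y c V W)
    (hYb : Bornology.IsBounded Y) (hYc : Convex ℝ Y) (hLu : UniqueDiffOn ℝ (closure Y))
    [IsFiniteMeasure ν] (hν : ν (closure Y)ᶜ = 0) :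
    ContDiffOn ℝ k (meanPotential V W ν) (closure Y) :=
  h.2.1.add (contDiffOn_integral_param hYb.isCompact_closure hYc.closure hLu
    hYb.isCompact_closure hν k h.2.2)

theorem SmoothData.contDiffOn_totalCost {k : ℕ} (h : SmoothData k X Y c V W)
    (hYb : Bornology.IsBounded Y) (hYc : Convex ℝ Y) (hLu : UniqueDiffOn ℝ (closure Y))
    [IsFiniteMeasure ν] (hν : ν (closure Y)ᶜ = 0) :
    ContDiffOn ℝ k (Function.uncurry (totalCost c V W ν)) (closure X ×ˢ closure Y) :=
  h.1.add ((h.contDiffOn_meanPotential hYb hYc hLu hν).comp contDiffOn_snd (fun _ hp => hp.2))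

theorem fderivWithin_totalCost (h : SmoothData 2 X Y c V W)
    (hYb : Bornology.IsBounded Y) (hYc : Convex ℝ Y) (hLu : UniqueDiffOn ℝ (closure Y))
    [IsFiniteMeasure ν] (hν : ν (closure Y)ᶜ = 0) {x : E} (hx : x ∈ closure X) {y : F}
    (hy : y ∈ closure Y) :
    fderivWithin ℝ (totalCost c V W ν x) (closure Y) y =
      fderivWithin ℝ (c x) (closure Y) y + (fderivWithin ℝ V (closure Y) y
        + ∫ z, fderivWithin ℝ (fun y' => W y' z) (closure Y) y ∂ν) := by
  have h1 := ((h.1.slice_right hx).differentiableOn (by simp) y hy).hasFDerivWithinAt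
  have h2 := (h.2.1.differentiableOn (by simp) y hy).hasFDerivWithinAt
  have h3 := hasFDerivWithinAt_integral_param hYb.isCompact_closure hYc.closure hLu
    hYb.isCompact_closure hν (h.2.2.of_le (by norm_num)) hy
  exact (h1.add (h2.add h3)).fderivWithin (hLu y hy)

theorem fderivWithin_totalCost_eq_zero_iff (h : SmoothData 2 X Y c V W)
    (hYb : Bornology.IsBounded Y) (hYc : Convex ℝ Y) (hLu : UniqueDiffOn ℝ (closure Y))
    [IsFiniteMeasure ν] (hν : ν (closure Y)ᶜ = 0) {x : E} (hx : x ∈ closure X) {y : F}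
    (hy : y ∈ closure Y) :
    fderivWithin ℝ (totalCost c V W ν x) (closure Y) y = 0 ↔
      fderivWithin ℝ (c x) (closure Y) y =
        -fderivWithin ℝ (meanPotential V W ν) (closure Y) y := by
  have h1 := ((h.1.slice_right hx).differentiableOn (by simp) y hy).hasFDerivWithinAt
  have h2 := ((h.contDiffOn_meanPotential hYb hYc hLu hν).differentiableOn (by simp) y
    hy).hasFDerivWithinAt
  have h3 : fderivWithin ℝ (totalCost c V W ν x) (closure Y) y = _ :=
    (h1.add h2).fderivWithin (hLu y hy)
  rw [h3, add_eq_zero_iff_eq_neg]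

theorem integrable_fderivWithin_left (h : SmoothData 2 X Y c V W)
    (hYb : Bornology.IsBounded Y) (hLu : UniqueDiffOn ℝ (closure Y))
    [IsFiniteMeasure ν] (hν : ν (closure Y)ᶜ = 0) {y : F} (hy : y ∈ closure Y) :
    Integrable (fun z => fderivWithin ℝ (fun y' => W y' z) (closure Y) y) ν :=
  integrable_of_continuousOn_compact hYb.isCompact_closure hν
    ((contDiffOn_fderivWithin_left (j := 1) h.2.2 hLu).continuousOn.comp
      (f := fun z => (y, z)) (by fun_prop) (fun _ hz => ⟨hy, hz⟩))

/-- Both hypotheses hold for each `z` and are averaged in `z`. As `ν` has mass one, `C` and the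
terms in `c` and `V` are unchanged. -/
theorem exists_stronglyConvexFamily [FiniteDimensional ℝ E] (hXb : Bornology.IsBounded X)
    (hYo : IsOpen Y) (hYb : Bornology.IsBounded Y) (hYc : Convex ℝ Y)
    (hsmooth : SmoothData 2 X Y c V W)
    (hWsymm : ∀ y ∈ closure Y, ∀ z ∈ closure Y, W y z = W z y)
    (hconv : UniformConvexity X Y c V W) (hout : OutwardGradient X Y c V W)
    (hν : ν ∈ ProbOn (closure Y)) :
    ∃ C, StronglyConvexFamily (closure X) (closure Y) (totalCost c V W ν) C := by
  obtain ⟨hprob, hν0⟩ := hν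
  obtain ⟨C, hC, hconv⟩ := hconv
  have hne : (closure Y).Nonempty := by
    rw [nonempty_iff_ne_empty]
    intro h
    rw [h, compl_empty, measure_univ] at hν0
    exact one_ne_zero hν0
  have hLu := uniqueDiffOn_closure hYo hYc hne
  have hYint : Y ⊆ interior (closure Y) := interior_maximal subset_closure hYo
  refine ⟨C, hC, hXb.isCompact_closure, hYb.isCompact_closure, hYc.closure, hne, hLu,
    closure_mono hYint, hsmooth.contDiffOn_totalCost hYb hYc hLu hν0, ?_, ?_⟩
  · intro x hx y hy y' hy'
    have hi := integrable_fderivWithin_left hsmooth hYb hLu hν0 hy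
    have hi' := integrable_fderivWithin_left hsmooth hYb hLu hν0 hy'
    have hia := hi.apply_continuousLinearMap (y' - y)
    have hia' := hi'.apply_continuousLinearMap (y' - y)
    rw [fderivWithin_totalCost hsmooth hYb hYc hLu hν0 hx hy,
      fderivWithin_totalCost hsmooth hYb hYc hLu hν0 hx hy']
    simp only [add_apply]
    rw [ContinuousLinearMap.integral_apply hi, ContinuousLinearMap.integral_apply hi']
    have hle : ∫ _, (C * ‖y' - y‖ ^ 2
        - (fderivWithin ℝ (c x) (closure Y) y' (y' - y) + fderivWithin ℝ V (closure Y) y' (y' - y))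
        + (fderivWithin ℝ (c x) (closure Y) y (y' - y) + fderivWithin ℝ V (closure Y) y (y' - y)))
          ∂ν ≤ ∫ z, (fderivWithin ℝ (fun y' => W y' z) (closure Y) y' (y' - y)
            - fderivWithin ℝ (fun y' => W y' z) (closure Y) y (y' - y)) ∂ν := by
      refine integral_mono_ae (integrable_const _) (hia'.sub hia) ?_
      filter_upwards [ae_mem_of_compl_null hν0] with z hz
      have := mono_of_uniformConvexity hYo hYc hLu hsmooth hWsymm hconv hx hy hy' hz
      linarith
    rw [integral_sub hia' hia, integral_const, probReal_univ, one_smul] at hle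
    linarith
  · intro x hx y hy hmin
    have hi := integrable_fderivWithin_left hsmooth hYb hLu hν0 hy
    have hD := fderivWithin_totalCost hsmooth hYb hYc hLu hν0 hx hy
    set D := fderivWithin ℝ (totalCost c V W ν x) (closure Y) y with hDdef
    have hnn : ∀ w ∈ closure Y, 0 ≤ D (w - y) := fun w hw =>
      hmin.localize.fderivWithin_nonneg
        (sub_mem_posTangentConeAt_of_segment_subset (hYc.closure.segment_subset hy hw))
    by_contra hne0
    set q := (InnerProductSpace.toDual ℝ F).symm D with hq
    have hqD : ∀ v, inner ℝ q v = D v := fun v => InnerProductSpace.toDual_symm_apply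
    have hq0 : 0 < ‖q‖ := by
      rw [norm_pos_iff, hq]
      simpa using hne0
    -- The normalized descent direction at a supposedly noncritical minimum; the variational
    -- inequality `hnn` makes it an outward normal.
    set p := -(‖q‖⁻¹ • q) with hpdef
    have hDp : D p = -‖q‖ := by
      rw [hpdef, map_neg, map_smul, ← hqD, real_inner_self_eq_norm_sq, smul_eq_mul]
      field_simp
    have hp : IsOutwardUnitNormal Y y p := by
      refine ⟨by rw [hpdef, norm_neg, norm_smul, norm_inv, norm_norm, inv_mul_cancel₀ hq0.ne'], ?_⟩
      intro w hw
      rw [hpdef, inner_neg_left, real_inner_smul_left, hqD]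
      have := hnn w (subset_closure hw)
      have := inv_pos.2 hq0
      nlinarith [mul_nonneg this.le (hnn w (subset_closure hw))]
    -- In the interior a short move along `p` stays in `Y` and contradicts `hnn`; on the boundary
    -- the averaged outward condition gives `0 ≤ D p`, against `D p = -‖q‖`.
    by_cases hyY : y ∈ Y
    · have h1 : Tendsto (fun t : ℝ => y + t • p) (𝓝 0) (𝓝 y) := by
        have : Continuous (fun t : ℝ => y + t • p) := by fun_prop
        simpa using this.tendsto 0
      have h2 : ∀ᶠ t : ℝ in 𝓝[>] 0, y + t • p ∈ Y :=
        (h1.eventually_mem (hYo.mem_nhds hyY)).filter_mono nhdsWithin_le_nhds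
      obtain ⟨t, ht, ht0⟩ := (h2.and self_mem_nhdsWithin).exists
      have ht0 : 0 < t := ht0
      have h3 := hnn _ (subset_closure ht)
      rw [add_sub_cancel_left, map_smul, hDp, smul_eq_mul] at h3
      nlinarith
    · have hfr : y ∈ frontier Y := ⟨hy, by rwa [hYo.interior_eq]⟩
      have h0 : 0 ≤ D p := by
        rw [hD]
        simp only [add_apply]
        rw [ContinuousLinearMap.integral_apply hi]
        have hle : ∫ _, -(fderivWithin ℝ (c x) (closure Y) y p + fderivWithin ℝ V (closure Y) y p)
            ∂ν ≤ ∫ z, fderivWithin ℝ (fun y' => W y' z) (closure Y) y p ∂ν := by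
          refine integral_mono_ae (integrable_const _) (hi.apply_continuousLinearMap p) ?_
          filter_upwards [ae_mem_of_compl_null hν0] with z hz
          have := outwardGradient_closure hLu hsmooth hout hx hfr hz hp
          linarith
        rw [integral_const, probReal_univ, one_smul] at hle
        linarith
      linarith

end Model

/-! ### Couplings, mixtures and convexity of the transport cost. -/

section Couplings
open Set Filter Topology

variable {E F : Type*} [MeasurableSpace E] [MeasurableSpace F]
  {μ : Measure E} {ν ν' : Measure F} {K : Set E} {L : Set F} {γ γ' : Measure (E × F)}
  {c : E → F → ℝ} {t : ℝ}

theorem isProbabilityMeasure_of_mem_couplings (hμ : IsProbabilityMeasure μ)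
    (hγ : γ ∈ Couplings μ ν) : IsProbabilityMeasure γ := by
  constructor
  rw [← hμ.measure_univ, ← hγ.1, Measure.map_apply measurable_fst MeasurableSet.univ,
    preimage_univ]

theorem couplings_compl_null (hγ : γ ∈ Couplings μ ν) (hμ : μ Kᶜ = 0) (hν : ν Lᶜ = 0) :
    γ (K ×ˢ L)ᶜ = 0 := by
  have h1 : ∀ᵐ p ∂γ, p.1 ∈ K := ae_of_ae_map measurable_fst.aemeasurable
    (p := fun x => x ∈ K) (by rw [hγ.1]; exact ae_mem_of_compl_null hμ)
  have h2 : ∀ᵐ p ∂γ, p.2 ∈ L := ae_of_ae_map measurable_snd.aemeasurable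
    (p := fun x => x ∈ L) (by rw [hγ.2]; exact ae_mem_of_compl_null hν)
  exact (h1.and h2 : ∀ᵐ p ∂γ, p ∈ K ×ˢ L)

theorem integral_fst_of_mem_couplings (hγ : γ ∈ Couplings μ ν) {f : E → ℝ}
    (hf : Integrable f μ) : Integrable (fun p => f p.1) γ ∧ ∫ p, f p.1 ∂γ = ∫ x, f x ∂μ := by
  obtain ⟨h1, -⟩ := hγ
  subst h1
  exact ⟨hf.comp_measurable measurable_fst,
    (integral_map measurable_fst.aemeasurable hf.aestronglyMeasurable).symm⟩

theorem integral_snd_of_mem_couplings (hγ : γ ∈ Couplings μ ν) {f : F → ℝ}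
    (hf : Integrable f ν) : Integrable (fun p => f p.2) γ ∧ ∫ p, f p.2 ∂γ = ∫ y, f y ∂ν := by
  obtain ⟨-, h2⟩ := hγ
  subst h2
  exact ⟨hf.comp_measurable measurable_snd,
    (integral_map measurable_snd.aemeasurable hf.aestronglyMeasurable).symm⟩

theorem graph_mem_couplings {T : E → F} (hT : AEMeasurable T μ) :
    μ.map (fun x => (x, T x)) ∈ Couplings μ (μ.map T) := by
  have h : AEMeasurable (fun x => (x, T x)) μ := aemeasurable_id.prodMk hT
  constructor
  · rw [AEMeasurable.map_map_of_aemeasurable measurable_fst.aemeasurable h]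
    exact Measure.map_id
  · rw [AEMeasurable.map_map_of_aemeasurable measurable_snd.aemeasurable h]
    rfl

theorem map_mem_probOn (hμ : μ ∈ ProbOn K) (hL : MeasurableSet L) {T : E → F}
    (hT : AEMeasurable T μ) (hTm : MapsTo T K L) : μ.map T ∈ ProbOn L := by
  have := hμ.1
  refine ⟨Measure.isProbabilityMeasure_map hT, ?_⟩
  have : ∀ᵐ y ∂(μ.map T), y ∈ L := by
    rw [ae_map_iff (p := fun y => y ∈ L) hT hL]
    filter_upwards [ae_mem_of_compl_null hμ.2] with x hx using hTm hx
  exact this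

/-- Keeps the infimum in `transportCost` from being the default value of `sInf ∅`. -/
theorem prod_mem_couplings [IsProbabilityMeasure μ] [IsProbabilityMeasure ν] :
    μ.prod ν ∈ Couplings μ ν := by
  constructor <;> simp

theorem le_transportCost (hμ : μ ∈ ProbOn K) (hν : ν ∈ ProbOn L) {a : ℝ}
    (h : ∀ γ ∈ Couplings μ ν, a ≤ ∫ p, c p.1 p.2 ∂γ) : a ≤ transportCost c μ ν := by
  have := hμ.1
  have := hν.1
  refine le_csInf ⟨_, _, prod_mem_couplings, rfl⟩ ?_
  rintro _ ⟨γ, hγ, rfl⟩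
  exact h γ hγ

/-- Nearly optimal plans are enough for the argument, so the existence of an optimal plan is never
required. -/
theorem exists_coupling_lt (hμ : μ ∈ ProbOn K) (hν : ν ∈ ProbOn L) {η : ℝ} (hη : 0 < η) :
    ∃ γ ∈ Couplings μ ν, ∫ p, c p.1 p.2 ∂γ < transportCost c μ ν + η := by
  have := hμ.1
  have := hν.1
  obtain ⟨_, ⟨γ, hγ, rfl⟩, h⟩ := exists_lt_of_csInf_lt
    (s := (fun γ : Measure (E × F) => ∫ p, c p.1 p.2 ∂γ) '' Couplings μ ν)
    ⟨_, _, prod_mem_couplings, rfl⟩ (lt_add_of_pos_right (transportCost c μ ν) hη)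
  exact ⟨γ, hγ, h⟩

/-- The convex combination `(1 - t) ρ + t ρ'` of two measures. -/
noncomputable def mixture {Ω : Type*} [MeasurableSpace Ω] (t : ℝ) (ρ ρ' : Measure Ω) :
    Measure Ω :=
  ENNReal.ofReal (1 - t) • ρ + ENNReal.ofReal t • ρ'

theorem integral_mixture {Ω : Type*} [MeasurableSpace Ω] {ρ ρ' : Measure Ω} (ht : t ∈ Icc (0 : ℝ) 1)
    {f : Ω → ℝ} (hf : Integrable f ρ) (hf' : Integrable f ρ') :
    ∫ ω, f ω ∂(mixture t ρ ρ') = (1 - t) * ∫ ω, f ω ∂ρ + t * ∫ ω, f ω ∂ρ' := by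
  rw [mixture, integral_add_measure (hf.smul_measure ENNReal.ofReal_ne_top)
    (hf'.smul_measure ENNReal.ofReal_ne_top), integral_smul_measure, integral_smul_measure,
    ENNReal.toReal_ofReal (sub_nonneg.2 ht.2), ENNReal.toReal_ofReal ht.1]
  rfl

theorem mixture_mem_probOn {Ω : Type*} [MeasurableSpace Ω] {ρ ρ' : Measure Ω} {S : Set Ω}
    (ht : t ∈ Icc (0 : ℝ) 1) (hρ : ρ ∈ ProbOn S) (hρ' : ρ' ∈ ProbOn S) :
    mixture t ρ ρ' ∈ ProbOn S := by
  have := hρ.1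
  have := hρ'.1
  refine ⟨⟨?_⟩, ?_⟩
  · simp only [mixture, Measure.add_apply, Measure.smul_apply, measure_univ, smul_eq_mul, mul_one]
    rw [← ENNReal.ofReal_add (sub_nonneg.2 ht.2) ht.1]
    simp
  · simp [mixture, hρ.2, hρ'.2]

theorem mixture_self {Ω : Type*} [MeasurableSpace Ω] {ρ : Measure Ω} (ht : t ∈ Icc (0 : ℝ) 1) :
    mixture t ρ ρ = ρ := by
  rw [mixture, ← add_smul, ← ENNReal.ofReal_add (sub_nonneg.2 ht.2) ht.1]
  simp

theorem mixture_mem_couplings (ht : t ∈ Icc (0 : ℝ) 1) (hγ : γ ∈ Couplings μ ν)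
    (hγ' : γ' ∈ Couplings μ ν') : mixture t γ γ' ∈ Couplings μ (mixture t ν ν') := by
  constructor
  · conv_rhs => rw [← mixture_self (ρ := μ) ht]
    rw [mixture, Measure.map_add _ _ measurable_fst, Measure.map_smul, Measure.map_smul,
      hγ.1, hγ'.1, mixture]
  · rw [mixture, Measure.map_add _ _ measurable_snd, Measure.map_smul, Measure.map_smul,
      hγ.2, hγ'.2, mixture]

variable [NormedAddCommGroup E] [NormedAddCommGroup F]

theorem bddBelow_transport (hμ : μ ∈ ProbOn K) (hν : ν ∈ ProbOn L) (hK : IsCompact K)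
    (hL : IsCompact L) (hc : ContinuousOn (Function.uncurry c) (K ×ˢ L)) :
    BddBelow ((fun γ : Measure (E × F) => ∫ p, c p.1 p.2 ∂γ) '' Couplings μ ν) := by
  obtain ⟨B, hB⟩ := (hK.prod hL).exists_bound_of_continuousOn hc
  refine ⟨-B, ?_⟩
  rintro _ ⟨γ, hγ, rfl⟩
  have := isProbabilityMeasure_of_mem_couplings hμ.1 hγ
  have h1 : ‖∫ p, c p.1 p.2 ∂γ‖ ≤ B * γ.real univ :=
    norm_integral_le_of_norm_le_const (by
      filter_upwards [ae_mem_of_compl_null (couplings_compl_null hγ hμ.2 hν.2)] with p hp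
      exact hB p hp)
  rw [probReal_univ, mul_one] at h1
  exact (abs_le.1 h1).1

theorem transportCost_le (hμ : μ ∈ ProbOn K) (hν : ν ∈ ProbOn L) (hK : IsCompact K)
    (hL : IsCompact L) (hc : ContinuousOn (Function.uncurry c) (K ×ˢ L))
    (hγ : γ ∈ Couplings μ ν) : transportCost c μ ν ≤ ∫ p, c p.1 p.2 ∂γ :=
  csInf_le (bddBelow_transport hμ hν hK hL hc) ⟨γ, hγ, rfl⟩

variable [BorelSpace E] [BorelSpace F]

theorem aemeasurable_of_continuousOn (hK : IsCompact K) (hμ : μ Kᶜ = 0) {T : E → F}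
    (hT : ContinuousOn T K) : AEMeasurable T μ := by
  rw [← Measure.restrict_eq_self_of_ae_mem (ae_mem_of_compl_null hμ)]
  exact hT.aemeasurable hK.measurableSet

variable [SecondCountableTopology E] [SecondCountableTopology F]

theorem integrable_of_mem_couplings {G : Type*} [NormedAddCommGroup G]
    (hμ : μ ∈ ProbOn K) (hν : ν ∈ ProbOn L) (hK : IsCompact K) (hL : IsCompact L)
    (hγ : γ ∈ Couplings μ ν) {f : E × F → G} (hf : ContinuousOn f (K ×ˢ L)) :
    Integrable f γ := by
  have := isProbabilityMeasure_of_mem_couplings hμ.1 hγ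
  exact integrable_of_continuousOn_compact (hK.prod hL) (couplings_compl_null hγ hμ.2 hν.2) hf

theorem transportCost_mixture_le (hμ : μ ∈ ProbOn K) (hν : ν ∈ ProbOn L) (hν' : ν' ∈ ProbOn L)
    (hK : IsCompact K) (hL : IsCompact L) (hc : ContinuousOn (Function.uncurry c) (K ×ˢ L))
    (ht : t ∈ Ioo (0 : ℝ) 1) (hγ' : γ' ∈ Couplings μ ν') :
    transportCost c μ (mixture t ν ν') ≤
      (1 - t) * transportCost c μ ν + t * ∫ p, c p.1 p.2 ∂γ' := by
  have ht' : t ∈ Icc (0 : ℝ) 1 := Ioo_subset_Icc_self ht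
  have h1 : 0 < 1 - t := sub_pos.2 ht.2
  -- Solved for `transportCost c μ ν`, the claim is a lower bound over all plans `γ`, obtained by
  -- mixing `γ` with `γ'`.
  have key : (transportCost c μ (mixture t ν ν') - t * ∫ p, c p.1 p.2 ∂γ') / (1 - t)
      ≤ transportCost c μ ν := by
    refine le_transportCost hμ hν fun γ hγ => ?_
    rw [div_le_iff₀ h1]
    have h2 := transportCost_le hμ (mixture_mem_probOn ht' hν hν') hK hL hc
      (mixture_mem_couplings ht' hγ hγ')
    rw [integral_mixture (f := fun p : E × F => c p.1 p.2) ht'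
      (integrable_of_mem_couplings hμ hν hK hL hγ hc)
      (integrable_of_mem_couplings hμ hν' hK hL hγ' hc)] at h2
    linarith
  rw [div_le_iff₀ h1] at key
  linarith

end Couplings

/-! ### First variation of the energy. -/

section FirstVariation
open Set Filter Topology

variable {F : Type*} [NormedAddCommGroup F]
  [MeasurableSpace F] [BorelSpace F] {ν ν' : Measure F} {L : Set F} {V : F → ℝ}
  {W : F → F → ℝ}

theorem integrable_slice (hL : IsCompact L) (hW : ContinuousOn (Function.uncurry W) (L ×ˢ L))
    (hν : ν ∈ ProbOn L) {y : F} (hy : y ∈ L) : Integrable (W y) ν := by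
  have := hν.1
  exact integrable_of_continuousOn_compact hL hν.2
    (hW.comp (f := fun z => (y, z)) (by fun_prop) (fun z hz => ⟨hy, hz⟩))

theorem integrable_integral_slice (hL : IsCompact L)
    (hW : ContinuousOn (Function.uncurry W) (L ×ˢ L))
    (hν : ν ∈ ProbOn L) (hν' : ν' ∈ ProbOn L) : Integrable (fun y => ∫ z, W y z ∂ν) ν' := by
  have := hν.1
  have := hν'.1
  exact integrable_of_continuousOn_compact hL hν'.2
    (continuousOn_integral_param hL hL hν.2 hW)

variable [SecondCountableTopology F]

theorem interaction_symm (hL : IsCompact L) (hW : ContinuousOn (Function.uncurry W) (L ×ˢ L))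
    (hWsymm : ∀ y ∈ L, ∀ z ∈ L, W y z = W z y) (hν : ν ∈ ProbOn L) (hν' : ν' ∈ ProbOn L) :
    ∫ y, ∫ z, W y z ∂ν ∂ν' = ∫ y, ∫ z, W y z ∂ν' ∂ν := by
  have := hν.1
  have := hν'.1
  have hint : Integrable (Function.uncurry W) (ν'.prod ν) :=
    integrable_of_mem_couplings hν' hν hL hL prod_mem_couplings hW
  rw [integral_integral_swap hint]
  refine integral_congr_ae ?_
  filter_upwards [ae_mem_of_compl_null hν.2] with y hy
  refine integral_congr_ae ?_
  filter_upwards [ae_mem_of_compl_null hν'.2] with z hz using hWsymm z hz y hy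

/-- Symmetry merges the two cross terms; their factor `2` cancels the `1/2` in the energy, so
`meanPotential` carries `W` with coefficient one. -/
theorem interaction_mixture (hL : IsCompact L) (hW : ContinuousOn (Function.uncurry W) (L ×ˢ L))
    (hWsymm : ∀ y ∈ L, ∀ z ∈ L, W y z = W z y) (hν : ν ∈ ProbOn L) (hν' : ν' ∈ ProbOn L) {t : ℝ}
    (ht : t ∈ Icc (0 : ℝ) 1) :
    ∫ y, ∫ z, W y z ∂(mixture t ν ν') ∂(mixture t ν ν') =
      (1 - t) ^ 2 * ∫ y, ∫ z, W y z ∂ν ∂ν + 2 * t * (1 - t) * ∫ y, ∫ z, W y z ∂ν ∂ν'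
        + t ^ 2 * ∫ y, ∫ z, W y z ∂ν' ∂ν' := by
  have h1 : ∫ y, ∫ z, W y z ∂(mixture t ν ν') ∂(mixture t ν ν') =
      ∫ y, ((1 - t) * ∫ z, W y z ∂ν + t * ∫ z, W y z ∂ν') ∂(mixture t ν ν') := by
    refine integral_congr_ae ?_
    filter_upwards [ae_mem_of_compl_null (mixture_mem_probOn ht hν hν').2] with y hy
    exact integral_mixture ht (integrable_slice hL hW hν hy) (integrable_slice hL hW hν' hy)
  have i1 := (integrable_integral_slice hL hW hν hν).const_mul (1 - t)
  have i2 := (integrable_integral_slice hL hW hν' hν).const_mul t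
  have i3 := (integrable_integral_slice hL hW hν hν').const_mul (1 - t)
  have i4 := (integrable_integral_slice hL hW hν' hν').const_mul t
  have h2 := integral_mixture ht (i1.add i2) (i3.add i4)
  simp only [Pi.add_apply] at h2
  rw [h1, h2, integral_add i1 i2, integral_add i3 i4]
  simp only [integral_const_mul]
  rw [interaction_symm hL hW hWsymm hν' hν]
  ring

variable {E : Type*} [NormedAddCommGroup E] [SecondCountableTopology E]
  [MeasurableSpace E] [BorelSpace E] {μ : Measure E} {K : Set E} {c : E → F → ℝ}

/-- First-order optimality condition for minimizers of the energy. -/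
theorem energy_first_variation (hμ : μ ∈ ProbOn K) (hν : ν ∈ ProbOn L) (hν' : ν' ∈ ProbOn L)
    (hK : IsCompact K) (hL : IsCompact L) (hc : ContinuousOn (Function.uncurry c) (K ×ˢ L))
    (hV : ContinuousOn V L) (hW : ContinuousOn (Function.uncurry W) (L ×ˢ L))
    (hWsymm : ∀ y ∈ L, ∀ z ∈ L, W y z = W z y)
    (hmin : ∀ ν' ∈ ProbOn L, energy c V W μ ν ≤ energy c V W μ ν')
    {γ' : Measure (E × F)} (hγ' : γ' ∈ Couplings μ ν') :
    transportCost c μ ν + ∫ y, meanPotential V W ν y ∂ν ≤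
      ∫ p, c p.1 p.2 ∂γ' + ∫ y, meanPotential V W ν y ∂ν' := by
  have := hν.1
  have := hν'.1
  have iV := integrable_of_continuousOn_compact hL hν.2 hV
  have iV' := integrable_of_continuousOn_compact hL hν'.2 hV
  have e1 : ∫ y, meanPotential V W ν y ∂ν = ∫ y, V y ∂ν + ∫ y, ∫ z, W y z ∂ν ∂ν :=
    integral_add iV (integrable_integral_slice hL hW hν hν)
  have e2 : ∫ y, meanPotential V W ν y ∂ν' = ∫ y, V y ∂ν' + ∫ y, ∫ z, W y z ∂ν ∂ν' :=
    integral_add iV' (integrable_integral_slice hL hW hν hν')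
  rw [e1, e2]
  set A := ∫ p, c p.1 p.2 ∂γ' + (∫ y, V y ∂ν' + ∫ y, ∫ z, W y z ∂ν ∂ν')
    - (transportCost c μ ν + (∫ y, V y ∂ν + ∫ y, ∫ z, W y z ∂ν ∂ν)) with hA
  set B := (∫ y, ∫ z, W y z ∂ν ∂ν) / 2 - ∫ y, ∫ z, W y z ∂ν ∂ν'
    + (∫ y, ∫ z, W y z ∂ν' ∂ν') / 2 with hB
  -- Along the mixture the energy increases by at most `t * A + t² * B`; minimality, divided by `t`,
  -- gives this.
  have key : ∀ t ∈ Ioo (0 : ℝ) 1, 0 ≤ A + t * B := by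
    intro t ht
    have ht' := Ioo_subset_Icc_self ht
    have h1 := hmin _ (mixture_mem_probOn ht' hν hν')
    simp only [energy] at h1
    rw [integral_mixture ht' iV iV', interaction_mixture hL hW hWsymm hν hν' ht'] at h1
    have h2 := transportCost_mixture_le hμ hν hν' hK hL hc ht hγ'
    refine nonneg_of_mul_nonneg_right (a := t) ?_ ht.1
    rw [hA, hB]
    linarith
  have hlim : Tendsto (fun t : ℝ => A + t * B) (𝓝[>] 0) (𝓝 A) := by
    have : Continuous (fun t : ℝ => A + t * B) := by fun_prop
    simpa using (this.tendsto 0).mono_left nhdsWithin_le_nhds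
  have : 0 ≤ A := by
    refine ge_of_tendsto hlim ?_
    filter_upwards [Ioo_mem_nhdsGT (zero_lt_one (α := ℝ))] with t ht using key t ht
  linarith

end FirstVariation

/-! ### The equilibrium map transports `μ` to `ν` and is the unique optimal map. -/

section OptimalMap
open Set Filter Topology

/-- `T` minimizes `c x + Φ` over `L` with quadratic growth, and `ν` satisfies the first-order
optimality condition of the energy against the image of `μ` under `T`. -/
structure EquilibriumMap {E F : Type*} [NormedAddCommGroup E] [MeasurableSpace E]
    [NormedAddCommGroup F] [MeasurableSpace F] (K : Set E) (L : Set F) (c : E → F → ℝ)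
    (Φ : F → ℝ) (T : E → F) (C : ℝ) (μ : Measure E) (ν : Measure F) : Prop where
  pos : 0 < C
  left_mem : μ ∈ ProbOn K
  right_mem : ν ∈ ProbOn L
  compact_left : IsCompact K
  compact_right : IsCompact L
  continuousOn_cost : ContinuousOn (Function.uncurry c) (K ×ˢ L)
  continuousOn_potential : ContinuousOn Φ L
  mapsTo : MapsTo T K L
  continuousOn_map : ContinuousOn T K
  growth : ∀ x ∈ K, ∀ y ∈ L, c x (T x) + Φ (T x) + C / 2 * ‖y - T x‖ ^ 2 ≤ c x y + Φ y
  first_variation : transportCost c μ ν + ∫ y, Φ y ∂ν ≤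
    ∫ x, c x (T x) ∂μ + ∫ x, Φ (T x) ∂μ

/-- A bounded continuous function oscillates at most quadratically, up to an arbitrarily small
constant, on a compact set. -/
theorem exists_oscillation_le {F : Type*} [NormedAddCommGroup F] {L : Set F} (hL : IsCompact L)
    (f : BoundedContinuousFunction F ℝ) {ε : ℝ} (hε : 0 < ε) :
    ∃ M, 0 < M ∧ ∀ y ∈ L, ∀ y' ∈ L, |f y - f y'| ≤ ε + M * ‖y - y'‖ ^ 2 := by
  have hu := hL.uniformContinuousOn_of_continuous f.continuous.continuousOn
  obtain ⟨δ, hδ, h⟩ := Metric.uniformContinuousOn_iff.1 hu ε hε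
  have hn := norm_nonneg f
  -- For points at distance at least `δ` the quadratic term dominates the total oscillation `2‖f‖`;
  -- the `+ 1` keeps the constant positive.
  refine ⟨(2 * ‖f‖ + 1) / δ ^ 2, by positivity, fun y hy y' hy' => ?_⟩
  rcases lt_or_ge (dist y y') δ with h1 | h1
  · have h2 := (h y hy y' hy' h1).le
    rw [Real.dist_eq] at h2
    have : 0 ≤ (2 * ‖f‖ + 1) / δ ^ 2 * ‖y - y'‖ ^ 2 := by positivity
    linarith
  · rw [dist_eq_norm] at h1
    have h2 : |f y - f y'| ≤ 2 * ‖f‖ := by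
      have := f.dist_le_two_norm y y'
      rwa [Real.dist_eq] at this
    have h3 : 1 ≤ ‖y - y'‖ ^ 2 / δ ^ 2 := by
      rw [one_le_div (by positivity)]
      gcongr
    have h4 : (2 * ‖f‖ + 1) * 1 ≤ (2 * ‖f‖ + 1) * (‖y - y'‖ ^ 2 / δ ^ 2) := by gcongr
    have h5 : (2 * ‖f‖ + 1) / δ ^ 2 * ‖y - y'‖ ^ 2
      = (2 * ‖f‖ + 1) * (‖y - y'‖ ^ 2 / δ ^ 2) := by ring
    linarith

namespace EquilibriumMap

set_option linter.unusedSectionVars false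

variable {E F : Type*} [NormedAddCommGroup E] [SecondCountableTopology E]
  [MeasurableSpace E] [BorelSpace E]
  [NormedAddCommGroup F] [SecondCountableTopology F] [MeasurableSpace F] [BorelSpace F]
  {μ : Measure E} {ν : Measure F} {K : Set E} {L : Set F} {γ : Measure (E × F)}
  {c : E → F → ℝ} {Φ : F → ℝ} {T : E → F} {C : ℝ}

theorem aemeasurable (h : EquilibriumMap K L c Φ T C μ ν) : AEMeasurable T μ :=
  aemeasurable_of_continuousOn h.compact_left h.left_mem.2 h.continuousOn_map

theorem continuousOn_graph (h : EquilibriumMap K L c Φ T C μ ν) :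
    ContinuousOn (fun x => c x (T x)) K :=
  h.continuousOn_cost.comp (f := fun x => (x, T x)) (continuousOn_id.prodMk h.continuousOn_map)
    (fun _ hx => ⟨hx, h.mapsTo hx⟩)

theorem continuousOn_comp (h : EquilibriumMap K L c Φ T C μ ν) :
    ContinuousOn (fun x => Φ (T x)) K :=
  h.continuousOn_potential.comp h.continuousOn_map h.mapsTo

theorem integrable_left (h : EquilibriumMap K L c Φ T C μ ν) {f : E → ℝ}
    (hf : ContinuousOn f K) : Integrable f μ := by
  have := h.left_mem.1
  exact integrable_of_continuousOn_compact h.compact_left h.left_mem.2 hf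

theorem integrable_right (h : EquilibriumMap K L c Φ T C μ ν) {f : F → ℝ}
    (hf : ContinuousOn f L) : Integrable f ν := by
  have := h.right_mem.1
  exact integrable_of_continuousOn_compact h.compact_right h.right_mem.2 hf

theorem integrable_coupling (h : EquilibriumMap K L c Φ T C μ ν) (hγ : γ ∈ Couplings μ ν)
    {f : E × F → ℝ} (hf : ContinuousOn f (K ×ˢ L)) : Integrable f γ :=
  integrable_of_mem_couplings h.left_mem h.right_mem h.compact_left h.compact_right hγ hf

theorem continuousOn_displacement (h : EquilibriumMap K L c Φ T C μ ν) :
    ContinuousOn (fun p : E × F => p.2 - T p.1) (K ×ˢ L) :=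
  continuousOn_snd.sub (h.continuousOn_map.comp continuousOn_fst (fun _ hp => hp.1))

theorem integrable_displacement (h : EquilibriumMap K L c Φ T C μ ν) (hγ : γ ∈ Couplings μ ν) :
    Integrable (fun p : E × F => ‖p.2 - T p.1‖ ^ 2) γ :=
  h.integrable_coupling hγ (h.continuousOn_displacement.norm.pow 2)

/-- The cost of a plan exceeds that of the equilibrium map by a quadratic term. -/
theorem excess (h : EquilibriumMap K L c Φ T C μ ν) (hγ : γ ∈ Couplings μ ν) :
    ∫ x, c x (T x) ∂μ + ∫ x, Φ (T x) ∂μ + C / 2 * ∫ p, ‖p.2 - T p.1‖ ^ 2 ∂γ ≤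
      ∫ p, c p.1 p.2 ∂γ + ∫ y, Φ y ∂ν := by
  have i1 := integral_fst_of_mem_couplings hγ (h.integrable_left h.continuousOn_graph)
  have i2 := integral_fst_of_mem_couplings hγ (h.integrable_left h.continuousOn_comp)
  have i3 := h.integrable_displacement hγ
  have i4 : Integrable (fun p : E × F => c p.1 p.2) γ :=
    h.integrable_coupling hγ h.continuousOn_cost
  have i5 := integral_snd_of_mem_couplings hγ (h.integrable_right h.continuousOn_potential)
  have e1 := integral_add (i1.1.add i2.1) (i3.const_mul (C / 2))
  simp only [Pi.add_apply] at e1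
  rw [← i1.2, ← i2.2, ← i5.2, ← integral_const_mul, ← integral_add i1.1 i2.1,
    ← e1, ← integral_add i4 i5.1]
  refine integral_mono_ae ((i1.1.add i2.1).add (i3.const_mul _)) (i4.add i5.1) ?_
  filter_upwards [ae_mem_of_compl_null
    (couplings_compl_null hγ h.left_mem.2 h.right_mem.2)] with p hp
  exact h.growth p.1 hp.1 p.2 hp.2

/-- The `Φ` terms cancel between `excess` and the first variation: nearly optimal plans are
`L²`-close to the graph of `T`. -/
theorem displacement_le (h : EquilibriumMap K L c Φ T C μ ν) (hγ : γ ∈ Couplings μ ν) :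
    C / 2 * ∫ p, ‖p.2 - T p.1‖ ^ 2 ∂γ ≤ ∫ p, c p.1 p.2 ∂γ - transportCost c μ ν := by
  linarith [h.excess hγ, h.first_variation]

/-- For a test function `f`, the two integrals differ by at most the mean of `|f (T x) - f y|` under
any plan; the oscillation bound and `displacement_le` make this small for nearly optimal plans. -/
theorem map_eq (h : EquilibriumMap K L c Φ T C μ ν) : μ.map T = ν := by
  have := h.left_mem.1
  have := h.right_mem.1
  have hC := h.pos
  have := Measure.isProbabilityMeasure_map (μ := μ) h.aemeasurable
  refine ext_of_forall_integral_eq_of_IsFiniteMeasure fun f => ?_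
  rw [integral_map h.aemeasurable f.continuous.measurable.aestronglyMeasurable]
  refine eq_of_forall_dist_le fun ε hε => ?_
  obtain ⟨M, hM, hosc⟩ := exists_oscillation_le h.compact_right f (half_pos hε)
  obtain ⟨γ, hγ, hlt⟩ := exists_coupling_lt (c := c) h.left_mem h.right_mem
    (η := C / 2 * (ε / 2 / M)) (by positivity)
  have hprob := isProbabilityMeasure_of_mem_couplings h.left_mem.1 hγ
  have h1 : ∫ p, ‖p.2 - T p.1‖ ^ 2 ∂γ ≤ ε / 2 / M := by
    have := h.displacement_le hγ
    refine le_of_mul_le_mul_left ?_ (half_pos hC)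
    linarith
  have i1 := integral_fst_of_mem_couplings hγ
    (h.integrable_left (f.continuous.comp_continuousOn h.continuousOn_map))
  have i2 := integral_snd_of_mem_couplings hγ (h.integrable_right f.continuous.continuousOn)
  have i3 := h.integrable_displacement hγ
  simp only [Function.comp_apply] at i1
  rw [← i1.2, ← i2.2, Real.dist_eq, ← integral_sub i1.1 i2.1]
  calc |∫ p, (f (T p.1) - f p.2) ∂γ| ≤ ∫ p, |f (T p.1) - f p.2| ∂γ :=
        abs_integral_le_integral_abs
    _ ≤ ∫ p, (ε / 2 + M * ‖p.2 - T p.1‖ ^ 2) ∂γ := by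
        refine integral_mono_ae (i1.1.sub i2.1).abs
          ((integrable_const _).add (i3.const_mul M)) ?_
        filter_upwards [ae_mem_of_compl_null
          (couplings_compl_null hγ h.left_mem.2 h.right_mem.2)] with p hp
        rw [norm_sub_rev]
        exact hosc _ (h.mapsTo hp.1) _ hp.2
    _ = ε / 2 + M * ∫ p, ‖p.2 - T p.1‖ ^ 2 ∂γ := by
        rw [integral_add (integrable_const _) (i3.const_mul M), integral_const_mul]
        simp
    _ ≤ ε / 2 + M * (ε / 2 / M) := by gcongr
    _ = ε := by field_simp; ring

theorem integral_comp (h : EquilibriumMap K L c Φ T C μ ν) {f : F → ℝ} (hf : Integrable f ν) :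
    Integrable (fun x => f (T x)) μ ∧ ∫ y, f y ∂ν = ∫ x, f (T x) ∂μ := by
  have h1 := h.map_eq
  rw [← h1] at hf
  refine ⟨hf.comp_aemeasurable h.aemeasurable, ?_⟩
  rw [← h1]
  exact integral_map h.aemeasurable hf.aestronglyMeasurable

theorem graph_coupling (h : EquilibriumMap K L c Φ T C μ ν) {T' : E → F}
    (hT' : AEMeasurable T' μ) (hm : μ.map T' = ν) :
    μ.map (fun x => (x, T' x)) ∈ Couplings μ ν ∧
      ∫ p, c p.1 p.2 ∂(μ.map fun x => (x, T' x)) = ∫ x, c x (T' x) ∂μ := by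
  have h1 : μ.map (fun x => (x, T' x)) ∈ Couplings μ ν := by
    have := graph_mem_couplings hT'
    rwa [hm] at this
  exact ⟨h1, integral_map (aemeasurable_id.prodMk hT')
    (h.integrable_coupling h1 h.continuousOn_cost).aestronglyMeasurable⟩

/-- Now that `T_#μ = ν`, the `Φ` integrals agree; one inequality is `excess`, the other the first
variation. -/
theorem cost_eq (h : EquilibriumMap K L c Φ T C μ ν) :
    ∫ x, c x (T x) ∂μ = transportCost c μ ν := by
  have hC := h.pos
  have h1 := (h.integral_comp (h.integrable_right h.continuousOn_potential)).2
  refine le_antisymm (le_transportCost h.left_mem h.right_mem fun γ hγ => ?_)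
    (by linarith [h.first_variation])
  have h2 := h.excess hγ
  have h3 : 0 ≤ C / 2 * ∫ p, ‖p.2 - T p.1‖ ^ 2 ∂γ :=
    mul_nonneg (by positivity) (integral_nonneg fun p => by positivity)
  linarith

theorem isOptimalMap (h : EquilibriumMap K L c Φ T C μ ν) : IsOptimalMap c μ ν T :=
  ⟨h.aemeasurable, h.map_eq, h.cost_eq⟩

/-- The plan induced by an optimal map has zero excess, hence zero mean squared displacement from
`T`. -/
theorem ae_eq_of_isOptimalMap (h : EquilibriumMap K L c Φ T C μ ν) {T' : E → F}
    (hT' : IsOptimalMap c μ ν T') : T' =ᵐ[μ] T := by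
  obtain ⟨hm, hmap, hcost⟩ := hT'
  obtain ⟨h1, h2⟩ := h.graph_coupling hm hmap
  have h3 := h.displacement_le h1
  rw [h2, hcost, sub_self] at h3
  have h4 : 0 ≤ ∫ p, ‖p.2 - T p.1‖ ^ 2 ∂(μ.map fun x => (x, T' x)) :=
    integral_nonneg fun p => by positivity
  have h5 : ∫ p, ‖p.2 - T p.1‖ ^ 2 ∂(μ.map fun x => (x, T' x)) = 0 := by
    have := h.pos
    refine le_antisymm ?_ h4
    by_contra hlt
    have : 0 < C / 2 * ∫ p, ‖p.2 - T p.1‖ ^ 2 ∂(μ.map fun x => (x, T' x)) :=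
      mul_pos (by positivity) (not_le.1 hlt)
    linarith
  rw [integral_eq_zero_iff_of_nonneg (fun p => by positivity)
    (h.integrable_displacement h1)] at h5
  have h6 := ae_of_ae_map (aemeasurable_id.prodMk hm) h5
  filter_upwards [h6] with x hx
  have hx : ‖T' x - T x‖ ^ 2 = 0 := hx
  rw [sq_eq_zero_iff, norm_eq_zero, sub_eq_zero] at hx
  exact hx

end EquilibriumMap

end OptimalMap

/-! ### Kantorovich potentials: construction, nestedness and uniqueness. -/

section Potentials
open Set Filter Topology

/-- A minimum of a jointly continuous family over a compact set depends continuously on the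
parameter. -/
theorem continuousOn_of_isLeast {A B : Type*} [PseudoMetricSpace A] [PseudoMetricSpace B]
    {K : Set A} {L : Set B} (hK : IsCompact K) (hL : IsCompact L) {c : A → B → ℝ}
    (hc : ContinuousOn (Function.uncurry c) (K ×ˢ L)) {u : A → ℝ} {v : B → ℝ}
    (hu : ∀ x ∈ K, IsLeast ((fun y => c x y - v y) '' L) (u x)) : ContinuousOn u K := by
  have hcu := Metric.uniformContinuousOn_iff.1 ((hK.prod hL).uniformContinuousOn_of_continuous hc)
  have key : ∀ ε > 0, ∃ δ > 0, ∀ x ∈ K, ∀ x' ∈ K, dist x x' < δ → u x - u x' ≤ ε := by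
    intro ε hε
    obtain ⟨δ, hδ, h⟩ := hcu ε hε
    refine ⟨δ, hδ, fun x hx x' hx' hd => ?_⟩
    obtain ⟨y, hy, he⟩ := (hu x' hx').1
    have h1 := (hu x hx).2 ⟨y, hy, rfl⟩
    have h2 := h (x, y) ⟨hx, hy⟩ (x', y) ⟨hx', hy⟩ (by
      rw [Prod.dist_eq, dist_self]; exact max_lt hd hδ)
    rw [Real.dist_eq] at h2
    have h3 := (abs_lt.1 h2).2
    simp only [Function.uncurry_apply_pair] at h1 h3 he
    linarith
  rw [Metric.continuousOn_iff]
  intro x hx ε hε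
  obtain ⟨δ, hδ, h⟩ := key (ε / 2) (half_pos hε)
  refine ⟨δ, hδ, fun x' hx' hd => ?_⟩
  rw [Real.dist_eq, abs_lt]
  have h1 := h x hx x' hx' (by rwa [dist_comm])
  have h2 := h x' hx' x hx hd
  constructor <;> linarith

/-- A function squeezed between two functions with the same derivative at a contact point. -/
theorem HasFDerivWithinAt.squeeze {F : Type*} [NormedAddCommGroup F] [NormedSpace ℝ F]
    {s : Set F} {f g h : F → ℝ} {f' : F →L[ℝ] ℝ} {y : F} (hf : HasFDerivWithinAt f f' s y)
    (hh : HasFDerivWithinAt h f' s y) (hfg : ∀ z ∈ s, f z ≤ g z) (hgh : ∀ z ∈ s, g z ≤ h z)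
    (hf0 : f y = g y) (hh0 : h y = g y) : HasFDerivWithinAt g f' s y := by
  rw [hasFDerivWithinAt_iff_isLittleO, Asymptotics.isLittleO_iff] at *
  intro ε hε
  filter_upwards [hf hε, hh hε, self_mem_nhdsWithin] with z h1 h2 hz
  rw [Real.norm_eq_abs, abs_le] at *
  have h3 := hfg z hz
  have h4 := hgh z hz
  constructor <;> linarith

namespace EquilibriumMap

set_option linter.unusedSectionVars false

variable {E F : Type*} [NormedAddCommGroup E] [SecondCountableTopology E]
  [MeasurableSpace E] [BorelSpace E]
  [NormedAddCommGroup F] [SecondCountableTopology F] [MeasurableSpace F] [BorelSpace F]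
  {μ : Measure E} {ν : Measure F} {X : Set E} {Y : Set F} {K : Set E} {L : Set F}
  {c : E → F → ℝ} {Φ : F → ℝ} {T : E → F} {C : ℝ}

theorem ae_mem_image (h : EquilibriumMap K L c Φ T C μ ν) : ∀ᵐ y ∂ν, y ∈ T '' K := by
  have hm : MeasurableSet (T '' K) :=
    (h.compact_left.image_of_continuousOn h.continuousOn_map).measurableSet
  rw [← h.map_eq, ae_map_iff (p := fun y => y ∈ T '' K) h.aemeasurable hm]
  filter_upwards [ae_mem_of_compl_null h.left_mem.2] with x hx using mem_image_of_mem T hx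

theorem exists_conjugate (h : EquilibriumMap K L c Φ T C μ ν) : ∃ v : F → ℝ, ∀ y ∈ L,
    IsLeast ((fun x => c x y - (c x (T x) + Φ (T x))) '' K) (v y) := by
  have hne : K.Nonempty := by
    have := h.left_mem.1
    obtain ⟨x, hx⟩ := (ae_mem_of_compl_null h.left_mem.2).exists
    exact ⟨x, hx⟩
  have : ∀ y, ∃ r, y ∈ L → IsLeast ((fun x => c x y - (c x (T x) + Φ (T x))) '' K) r := by
    intro y
    by_cases hy : y ∈ L
    · have hc : ContinuousOn (fun x => c x y - (c x (T x) + Φ (T x))) K :=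
        (h.continuousOn_cost.comp (f := fun x => (x, y)) (by fun_prop)
          (fun x hx => ⟨hx, hy⟩)).sub (h.continuousOn_graph.add h.continuousOn_comp)
      obtain ⟨r, hr⟩ := (h.compact_left.image_of_continuousOn hc).exists_isLeast (hne.image _)
      exact ⟨r, fun _ => hr⟩
    · exact ⟨0, fun hy' => (hy hy').elim⟩
  choose v hv using this
  exact ⟨v, fun y hy => hv y hy⟩

variable {v : F → ℝ}

/-- `-Φ` is an admissible partner of `u(x) = min_y [c(x, y) + Φ(y)]`, and the conjugate is the
largest one. -/
theorem neg_le_conjugate (h : EquilibriumMap K L c Φ T C μ ν)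
    (hv : ∀ y ∈ L, IsLeast ((fun x => c x y - (c x (T x) + Φ (T x))) '' K) (v y)) {y : F}
    (hy : y ∈ L) : -Φ y ≤ v y := by
  obtain ⟨x, hx, he⟩ := (hv y hy).1
  have h1 := h.growth x hx y hy
  have h2 : 0 ≤ C / 2 * ‖y - T x‖ ^ 2 := mul_nonneg (half_pos h.pos).le (by positivity)
  simp only at he
  linarith

theorem conjugate_eq_neg (h : EquilibriumMap K L c Φ T C μ ν)
    (hv : ∀ y ∈ L, IsLeast ((fun x => c x y - (c x (T x) + Φ (T x))) '' K) (v y)) {x : E}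
    (hx : x ∈ K) : v (T x) = -Φ (T x) := by
  refine le_antisymm ?_ (h.neg_le_conjugate hv (h.mapsTo hx))
  have := (hv _ (h.mapsTo hx)).2 ⟨x, hx, rfl⟩
  simp only at this
  linarith

/-- Since `ν = T_#μ`, the dual objective is a single `μ`-integral with a pointwise bound, so dual
pairs can be compared almost everywhere. -/
theorem dual_le (h : EquilibriumMap (closure X) (closure Y) c Φ T C μ ν) {u' : E → ℝ}
    {v' : F → ℝ} (hd : DualAdmissible X Y c μ ν u' v') :
    ∫ x, u' x ∂μ + ∫ y, v' y ∂ν = ∫ x, (u' x + v' (T x)) ∂μ ∧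
      Integrable (fun x => u' x + v' (T x)) μ ∧
      ∀ᵐ x ∂μ, u' x + v' (T x) ≤ c x (T x) := by
  obtain ⟨hu, hv, hle⟩ := hd
  have h1 := h.integral_comp hv
  refine ⟨by rw [h1.2, integral_add hu h1.1], hu.add h1.1, ?_⟩
  filter_upwards [ae_mem_of_compl_null h.left_mem.2] with x hx using hle x hx _ (h.mapsTo hx)

theorem isKantorovichPair (h : EquilibriumMap (closure X) (closure Y) c Φ T C μ ν)
    (hv : ∀ y ∈ closure Y, IsLeast ((fun x => c x y - (c x (T x) + Φ (T x))) '' closure X) (v y)) :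
    IsKantorovichPair X Y c μ ν (fun x => c x (T x) + Φ (T x)) v := by
  have hle : ∀ x ∈ closure X, ∀ y ∈ closure Y, (c x (T x) + Φ (T x)) + v y ≤ c x y := by
    intro x hx y hy
    have := (hv y hy).2 ⟨x, hx, rfl⟩
    simp only at this
    linarith
  -- Integrability is inherited from `-Φ`, which equals `v` on the image of `T`.
  have hvi : Integrable v ν := by
    refine (h.integrable_right h.continuousOn_potential).neg.congr ?_
    filter_upwards [h.ae_mem_image] with y hy
    obtain ⟨x, hx, rfl⟩ := hy
    exact (h.conjugate_eq_neg hv hx).symm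
  have hadm : DualAdmissible X Y c μ ν (fun x => c x (T x) + Φ (T x)) v :=
    ⟨h.integrable_left (h.continuousOn_graph.add h.continuousOn_comp), hvi, hle⟩
  refine ⟨hadm, ?_, ?_, hv⟩
  · intro u' v' hd
    obtain ⟨e1, i1, l1⟩ := h.dual_le hd
    obtain ⟨e2, i2, -⟩ := h.dual_le hadm
    rw [e1, e2]
    refine integral_mono_ae i1 i2 ?_
    filter_upwards [l1, ae_mem_of_compl_null h.left_mem.2] with x hx hxK
    rw [h.conjugate_eq_neg hv hxK]
    linarith
  · intro x hx
    refine ⟨⟨T x, h.mapsTo hx, ?_⟩, ?_⟩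
    · simp only
      rw [h.conjugate_eq_neg hv hx]
      ring
    · rintro _ ⟨y, hy, rfl⟩
      have := hle x hx y hy
      simp only
      linarith

/-- Kantorovich potentials saturate the dual constraint along the optimal map. -/
theorem ae_add_eq (h : EquilibriumMap (closure X) (closure Y) c Φ T C μ ν) {u' : E → ℝ}
    {v' : F → ℝ} (hp : IsKantorovichPair X Y c μ ν u' v') :
    ∀ᵐ x ∂μ, u' x + v' (T x) = c x (T x) := by
  obtain ⟨v, hv⟩ := h.exists_conjugate
  obtain ⟨e1, i1, l1⟩ := h.dual_le hp.1
  have hpair := h.isKantorovichPair hv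
  obtain ⟨e2, i2, -⟩ := h.dual_le hpair.1
  have h1 := hp.2.1 _ _ hpair.1
  rw [e1, e2] at h1
  have hc := h.integrable_left h.continuousOn_graph
  have h2 : ∫ x, (c x (T x) + Φ (T x) + v (T x)) ∂μ = ∫ x, c x (T x) ∂μ := by
    refine integral_congr_ae ?_
    filter_upwards [ae_mem_of_compl_null h.left_mem.2] with x hx
    rw [h.conjugate_eq_neg hv hx]
    ring
  rw [h2] at h1
  have h3 := (integral_eq_iff_of_ae_le i1 hc l1).1 (le_antisymm (integral_mono_ae i1 hc l1) h1)
  filter_upwards [h3] with x hx using hx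

/-- By continuity, a failure at one point of `X` would persist on a neighbourhood, which has
positive `m`-measure, yet the failure set is `μ`-null and so `m`-null in `X`. -/
theorem add_eq_of_absolutelyContinuous
    (h : EquilibriumMap (closure X) (closure Y) c Φ T C μ ν) (hXo : IsOpen X) {m : Measure E}
    [m.IsOpenPosMeasure] (hac : m.restrict X ≪ μ) {u' : E → ℝ} {v' : F → ℝ}
    (hp : IsKantorovichPair X Y c μ ν u' v') {x : E} (hx : x ∈ X) :
    u' x + v' (T x) = c x (T x) := by
  have hu := continuousOn_of_isLeast h.compact_left h.compact_right h.continuousOn_cost hp.2.2.1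
  have hv : ContinuousOn v' (closure Y) := by
    refine continuousOn_of_isLeast (c := fun y x => c x y) h.compact_right h.compact_left ?_
      hp.2.2.2
    exact h.continuousOn_cost.comp (f := fun q : F × E => (q.2, q.1)) (by fun_prop)
      (fun q hq => ⟨hq.2, hq.1⟩)
  have hf : ContinuousOn (fun x => u' x + v' (T x)) (closure X) :=
    hu.add (hv.comp h.continuousOn_map h.mapsTo)
  have hKn : closure X ∈ 𝓝 x := mem_of_superset (hXo.mem_nhds hx) subset_closure
  have hae : ∀ᵐ z ∂m, z ∈ X → u' z + v' (T z) = c z (T z) :=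
    (ae_restrict_iff' hXo.measurableSet).1 (hac.ae_le (h.ae_add_eq hp))
  by_contra hne
  have h1 : ∀ᶠ z in 𝓝 x, u' z + v' (T z) ≠ c z (T z) :=
    (hf.continuousAt hKn).ne_iff_eventually_ne (h.continuousOn_graph.continuousAt hKn) |>.1 hne
  have h2 := Measure.measure_pos_of_mem_nhds m (inter_mem h1 (hXo.mem_nhds hx))
  refine h2.ne' (measure_mono_null ?_ hae)
  intro z hz hz'
  exact hz.1 (hz' hz.2)

/-- Neither `u₁` nor `u₂` need be known to be differentiable. The constraint at `(x, T x₀)` bounds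
the increment of one from above, the constraint at `(x₀, T x)` that of the other from below. Their
difference is at most a mixed difference of `c`, which is `o(‖x - x₀‖)` because `D_x c` and `T` are
continuous. -/
theorem hasFDerivAt_sub_eq_zero [NormedSpace ℝ E] [NormedSpace ℝ F]
    (h : EquilibriumMap (closure X) (closure Y) c Φ T C μ ν) (hXo : IsOpen X)
    (hc : ContDiffOn ℝ (2 : ℕ) (Function.uncurry c) (closure X ×ˢ closure Y))
    {u₁ u₂ : E → ℝ} {v₁ v₂ : F → ℝ}
    (hle₁ : ∀ x ∈ closure X, ∀ y ∈ closure Y, u₁ x + v₁ y ≤ c x y)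
    (hle₂ : ∀ x ∈ closure X, ∀ y ∈ closure Y, u₂ x + v₂ y ≤ c x y)
    (he₁ : ∀ x ∈ X, u₁ x + v₁ (T x) = c x (T x))
    (he₂ : ∀ x ∈ X, u₂ x + v₂ (T x) = c x (T x)) {x₀ : E} (hx₀ : x₀ ∈ X) :
    HasFDerivAt (fun x => u₁ x - u₂ x) (0 : E →L[ℝ] ℝ) x₀ := by
  have hs := subset_closure (s := X)
  have hcX : ContDiffOn ℝ (2 : ℕ) (Function.uncurry c) (X ×ˢ closure Y) :=
    hc.mono (prod_mono hs Subset.rfl)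
  have hD := (contDiffOn_fderivWithin_left (j := 1) hcX hXo.uniqueDiffOn).continuousOn
  have hT₀ : T x₀ ∈ closure Y := h.mapsTo (hs hx₀)
  have hTc : ContinuousAt T x₀ :=
    h.continuousOn_map.continuousAt (mem_of_superset (hXo.mem_nhds hx₀) hs)
  rw [hasFDerivAt_iff_isLittleO, Asymptotics.isLittleO_iff]
  intro ε hε
  obtain ⟨δ, hδ, hDδ⟩ := Metric.continuousOn_iff.1 hD (x₀, T x₀) ⟨hx₀, hT₀⟩ (ε / 2) (half_pos hε)
  obtain ⟨r₀, hr₀, hball₀⟩ := Metric.isOpen_iff.1 hXo x₀ hx₀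
  set r := min r₀ δ with hr
  have hr_pos : 0 < r := lt_min hr₀ hδ
  have hball : Metric.ball x₀ r ⊆ X := (Metric.ball_subset_ball (min_le_left _ _)).trans hball₀
  filter_upwards [Metric.ball_mem_nhds x₀ hr_pos, hTc (Metric.ball_mem_nhds (T x₀) hδ)]
    with x hx hTx
  have hxX := hball hx
  have hTxL : T x ∈ closure Y := h.mapsTo (hs hxX)
  -- Mean value inequality for `ξ ↦ c ξ (T x₀) - c ξ (T x)`; both derivatives are within `ε / 2` of
  -- `D_x c(x₀, T x₀)`.
  have hmv : ‖(c x (T x₀) - c x (T x)) - (c x₀ (T x₀) - c x₀ (T x))‖ ≤ ε * ‖x - x₀‖ := by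
    refine Convex.norm_image_sub_le_of_norm_hasFDerivWithin_le (𝕜 := ℝ) (s := Metric.ball x₀ r)
      (f := fun ξ => c ξ (T x₀) - c ξ (T x))
      (f' := fun ξ => fderivWithin ℝ (fun x => c x (T x₀)) X ξ
        - fderivWithin ℝ (fun ξ => c ξ (T x)) X ξ) ?_ ?_ (convex_ball x₀ r)
      (Metric.mem_ball_self hr_pos) hx
    · intro ξ hξ
      have h1 := ((hcX.slice_left hT₀).differentiableOn (by simp) ξ (hball hξ)).hasFDerivWithinAt
      have h2 := ((hcX.slice_left hTxL).differentiableOn (by simp) ξ (hball hξ)).hasFDerivWithinAt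
      exact (h1.sub h2).mono hball
    · intro ξ hξ
      have hξδ : dist ξ x₀ < δ := lt_of_lt_of_le hξ (min_le_right _ _)
      have h1 := hDδ (ξ, T x₀) ⟨hball hξ, hT₀⟩ (by
        rw [Prod.dist_eq, dist_self]; exact max_lt hξδ hδ)
      have h2 := hDδ (ξ, T x) ⟨hball hξ, hTxL⟩ (by
        rw [Prod.dist_eq]; exact max_lt hξδ hTx)
      rw [← dist_eq_norm]
      exact ((dist_triangle_right _ _ _).trans_lt (add_lt_add h1 h2)).le.trans
        (add_halves ε).le
  rw [Real.norm_eq_abs, abs_le] at hmv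
  rw [zero_apply, sub_zero, Real.norm_eq_abs, abs_le]
  have a₁ := hle₁ x (hs hxX) _ hT₀
  have a₂ := hle₂ x (hs hxX) _ hT₀
  have b₁ := hle₁ x₀ (hs hx₀) _ hTxL
  have b₂ := hle₂ x₀ (hs hx₀) _ hTxL
  have c₁ := he₁ x hxX
  have c₂ := he₂ x hxX
  have d₁ := he₁ x₀ hx₀
  have d₂ := he₂ x₀ hx₀
  constructor <;> linarith

/-- Zero derivative on a connected open set gives a constant, continuity extends it to `closure X`,
and conjugation transfers it to `v`. -/
theorem uniqueKantorovichPair [NormedSpace ℝ E] [NormedSpace ℝ F]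
    (h : EquilibriumMap (closure X) (closure Y) c Φ T C μ ν) (hXo : IsOpen X)
    (hXc : IsPreconnected X)
    (hc : ContDiffOn ℝ (2 : ℕ) (Function.uncurry c) (closure X ×ˢ closure Y)) {m : Measure E}
    [m.IsOpenPosMeasure] (hac : m.restrict X ≪ μ) : UniqueKantorovichPair X Y c μ ν := by
  intro u v u' v' hp hp'
  have hd : ∀ x ∈ X, HasFDerivAt (fun x => u' x - u x) (0 : E →L[ℝ] ℝ) x := fun x hx =>
    h.hasFDerivAt_sub_eq_zero hXo hc hp'.1.2.2 hp.1.2.2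
      (fun x hx => h.add_eq_of_absolutelyContinuous hXo hac hp' hx)
      (fun x hx => h.add_eq_of_absolutelyContinuous hXo hac hp hx) hx
  obtain ⟨a, ha⟩ := hXo.exists_is_const_of_fderiv_eq_zero hXc
    (fun x hx => (hd x hx).differentiableAt.differentiableWithinAt) (fun x hx => (hd x hx).fderiv)
  have hu := continuousOn_of_isLeast h.compact_left h.compact_right h.continuousOn_cost hp.2.2.1
  have hu' := continuousOn_of_isLeast h.compact_left h.compact_right h.continuousOn_cost hp'.2.2.1
  have hK : ∀ x ∈ closure X, u' x = u x + a := by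
    intro x hx
    have h1 : u' x - u x = a := by
      have := (hu'.sub hu x hx).mono subset_closure
      refine le_antisymm (this.closure_le hx continuousWithinAt_const fun z hz => (ha z hz).le)
        (ContinuousWithinAt.closure_le hx continuousWithinAt_const this fun z hz => (ha z hz).ge)
    linarith
  refine ⟨a, hK, fun y hy => ?_⟩
  obtain ⟨⟨x, hx, he⟩, hlb⟩ := hp.2.2.2 y hy
  obtain ⟨⟨x', hx', he'⟩, hlb'⟩ := hp'.2.2.2 y hy
  have h1 := hlb ⟨x', hx', rfl⟩
  have h2 := hlb' ⟨x, hx, rfl⟩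
  have h3 := hK x hx
  have h4 := hK x' hx'
  simp only at he he' h1 h2
  linarith

/-- For `ν`-almost every `y = T x₀`, both sets equal `{x | T x = y}`: the level set through `hcrit`,
the superdifferential through the strict quadratic growth. -/
theorem nestedFor [NormedSpace ℝ F]
    (h : EquilibriumMap (closure X) (closure Y) c Φ T C μ ν) (hLu : UniqueDiffOn ℝ (closure Y))
    (hcd : ∀ x ∈ closure X, DifferentiableOn ℝ (c x) (closure Y))
    (hΦ : DifferentiableOn ℝ Φ (closure Y))
    (hcrit : ∀ x ∈ closure X, ∀ y ∈ closure Y,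
      fderivWithin ℝ (c x) (closure Y) y = -fderivWithin ℝ Φ (closure Y) y ↔ y = T x)
    (hv : ∀ y ∈ closure Y, IsLeast ((fun x => c x y - (c x (T x) + Φ (T x))) '' closure X) (v y)) :
    NestedFor X Y c ν (fun x => c x (T x) + Φ (T x)) v := by
  filter_upwards [h.ae_mem_image] with y hy
  obtain ⟨x₀, hx₀, rfl⟩ := hy
  have hyL := h.mapsTo hx₀
  have hvT := h.conjugate_eq_neg hv hx₀
  have hder : HasFDerivWithinAt v (-fderivWithin ℝ Φ (closure Y) (T x₀)) (closure Y) (T x₀) := by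
    have h1 := ((hΦ _ hyL).hasFDerivWithinAt).neg
    have h2 := ((hcd x₀ hx₀ _ hyL).hasFDerivWithinAt).sub_const (c x₀ (T x₀) + Φ (T x₀))
    rw [(hcrit x₀ hx₀ _ hyL).2 rfl] at h2
    refine h1.squeeze h2 (fun z hz => h.neg_le_conjugate hv hz)
      (fun z hz => (hv z hz).2 ⟨x₀, hx₀, rfl⟩) hvT.symm ?_
    rw [hvT]
    ring
  refine ⟨hder.differentiableWithinAt, ?_⟩
  rw [hder.fderivWithin (hLu _ hyL)]
  ext x
  refine and_congr_right fun hx => ?_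
  rw [hcrit x hx _ hyL, hvT]
  constructor
  · intro he
    have h1 := h.growth x hx _ hyL
    have h2 : ‖T x₀ - T x‖ ^ 2 ≤ 0 := by
      have := h.pos
      by_contra hlt
      have : 0 < C / 2 * ‖T x₀ - T x‖ ^ 2 := mul_pos (by positivity) (not_le.1 hlt)
      linarith
    have h3 : ‖T x₀ - T x‖ = 0 := by
      rw [← sq_eq_zero_iff]; exact le_antisymm h2 (by positivity)
    exact sub_eq_zero.1 (norm_eq_zero.1 h3)
  · intro he
    simp only
    rw [← he]
    ring

end EquilibriumMap

/-- Nestedness of one pair of potentials passes to all pairs when these are unique up to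
constants. -/
theorem generalizedNested_of_unique {E F : Type*} [TopologicalSpace E] [MeasurableSpace E]
    [NormedAddCommGroup F] [NormedSpace ℝ F] [MeasurableSpace F] {X : Set E} {Y : Set F}
    {c : E → F → ℝ} {μ : Measure E} {ν : Measure F} {u : E → ℝ} {v : F → ℝ}
    (hν : ν (closure Y)ᶜ = 0) (hp : IsKantorovichPair X Y c μ ν u v)
    (hn : NestedFor X Y c ν u v) (hu : UniqueKantorovichPair X Y c μ ν) :
    GeneralizedNested X Y c μ ν := by
  refine ⟨⟨u, v, hp⟩, fun u' v' hp' => ?_⟩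
  obtain ⟨a, ha, hb⟩ := hu u v u' v' hp hp'
  filter_upwards [hn, ae_mem_of_compl_null hν] with y hy hyL
  obtain ⟨hd, hs⟩ := hy
  have hd' : fderivWithin ℝ v' (closure Y) y = fderivWithin ℝ v (closure Y) y := by
    rw [fderivWithin_congr hb (hb y hyL)]
    exact fderivWithin_sub_const a
  refine ⟨(hd.sub_const a).congr hb (hb y hyL), ?_⟩
  rw [hd', ← hs]
  ext x
  refine and_congr_right fun hx => ?_
  rw [ha x hx, hb y hyL]
  constructor <;> intro h <;> linarith

end Potentials

/-! ### Uniqueness of the critical point, and the main theorem. -/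

/-- Quadratic growth holds around each of two critical points; adding the two inequalities forces
their distance to vanish. -/
theorem StronglyConvexFamily.fderivWithin_eq_zero_iff {E F : Type*} [NormedAddCommGroup E]
    [NormedSpace ℝ E] [NormedAddCommGroup F] [NormedSpace ℝ F] {K : Set E} {L : Set F}
    {H : E → F → ℝ} {C : ℝ} (h : StronglyConvexFamily K L H C) {T : E → F}
    (hT : Set.MapsTo T K L) (h0 : ∀ x ∈ K, fderivWithin ℝ (H x) L (T x) = 0) {x : E} (hx : x ∈ K)
    {y : F} (hy : y ∈ L) : fderivWithin ℝ (H x) L y = 0 ↔ y = T x := by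
  refine ⟨fun hy0 => ?_, fun he => he ▸ h0 x hx⟩
  have h1 := h.growth_argmin hx hy hy0 (hT hx)
  have h2 := h.growth_argmin hx (hT hx) (h0 x hx) hy
  rw [norm_sub_rev] at h1
  have h3 : ‖y - T x‖ ^ 2 ≤ 0 := by
    have := h.pos
    by_contra hlt
    have : 0 < C / 2 * ‖y - T x‖ ^ 2 := mul_pos (by positivity) (not_le.1 hlt)
    linarith
  have h4 : ‖y - T x‖ = 0 := by
    rw [← sq_eq_zero_iff]; exact le_antisymm h3 (by positivity)
  exact sub_eq_zero.1 (norm_eq_zero.1 h4)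

theorem mainTheorem7 (m n : ℕ) (hmn : n < m)
    (X : Set (EuclideanSpace ℝ (Fin m))) (Y : Set (EuclideanSpace ℝ (Fin n)))
    (hXo : IsOpen X) (hXb : Bornology.IsBounded X)
    (hYo : IsOpen Y) (hYb : Bornology.IsBounded Y) (hYc : Convex ℝ Y)
    (c : EuclideanSpace ℝ (Fin m) → EuclideanSpace ℝ (Fin n) → ℝ)
    (V : EuclideanSpace ℝ (Fin n) → ℝ)
    (W : EuclideanSpace ℝ (Fin n) → EuclideanSpace ℝ (Fin n) → ℝ)
    (hsmooth : SmoothData 2 X Y c V W)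
    (hWsymm : ∀ y ∈ closure Y, ∀ z ∈ closure Y, W y z = W z y)
    (hconv : UniformConvexity X Y c V W)
    (hout : OutwardGradient X Y c V W)
    (μ : Measure (EuclideanSpace ℝ (Fin m))) (hμ : μ ∈ ProbOn (closure X))
    (ν : Measure (EuclideanSpace ℝ (Fin n))) (hν : ν ∈ ProbOn (closure Y))
    (hmin : ∀ ν' ∈ ProbOn (closure Y), energy c V W μ ν ≤ energy c V W μ ν') :
    (∃ u v, IsKantorovichPair X Y c μ ν u v ∧ NestedFor X Y c ν u v) ∧
    (UniqueKantorovichPair X Y c μ ν → GeneralizedNested X Y c μ ν) ∧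
    (IsConnected X → (volume.restrict X) ≪ μ →
      UniqueKantorovichPair X Y c μ ν ∧ GeneralizedNested X Y c μ ν) ∧
    (∃ T : EuclideanSpace ℝ (Fin m) → EuclideanSpace ℝ (Fin n),
      Set.MapsTo T (closure X) (closure Y) ∧
      IsOptimalMap c μ ν T ∧
      (∀ T', IsOptimalMap c μ ν T' → T' =ᵐ[μ] T) ∧
      ∀ k : ℕ, 2 ≤ k → SmoothData k X Y c V W →
        ContDiffOn ℝ ((k - 1 : ℕ) : WithTop ℕ∞) T (closure X)) := by
  have hXK := hXb.isCompact_closure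
  have hYL := hYb.isCompact_closure
  have hprob := hν.1
  have hμ1 := hμ.1
  obtain ⟨C, hS⟩ := exists_stronglyConvexFamily hXb hYo hYb hYc hsmooth hWsymm hconv hout hν
  have hLu := hS.uniqueDiff
  obtain ⟨T, hT, hT0⟩ := hS.exists_argmin
  have hTc := hS.continuousOn_argmin hT hT0
  have hc := hsmooth.1.continuousOn
  have hΦ := hsmooth.contDiffOn_meanPotential hYb hYc hLu hν.2
  have hTm := aemeasurable_of_continuousOn hXK hμ.2 hTc
  have hν' := map_mem_probOn hμ hYL.measurableSet hTm hT
  have hprob' := hν'.1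
  have hγ := graph_mem_couplings hTm
  -- The competitor is `T_#μ`, with the plan carried by the graph of `T`.
  have hfirst := energy_first_variation hμ hν hν' hXK hYL hc hsmooth.2.1.continuousOn
    hsmooth.2.2.continuousOn hWsymm hmin hγ
  have hgraph : AEMeasurable (fun x => (x, T x)) μ := aemeasurable_id.prodMk hTm
  rw [integral_map (f := fun p => c p.1 p.2) hgraph
      (integrable_of_mem_couplings hμ hν' hXK hYL hγ hc).aestronglyMeasurable,
    integral_map hTm (integrable_of_continuousOn_compact hYL hν'.2
      hΦ.continuousOn).aestronglyMeasurable] at hfirst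
  have hM : EquilibriumMap (closure X) (closure Y) c (meanPotential V W ν) T C μ ν :=
    ⟨hS.pos, hμ, hν, hXK, hYL, hc, hΦ.continuousOn, hT, hTc,
      fun x hx y hy => hS.growth_argmin hx (hT hx) (hT0 x hx) hy, hfirst⟩
  obtain ⟨v, hv⟩ := hM.exists_conjugate
  have hpair := hM.isKantorovichPair hv
  have hnest := hM.nestedFor hLu
    (fun x hx => (hsmooth.1.slice_right hx).differentiableOn (by simp))
    (hΦ.differentiableOn (by simp))
    (fun x hx y hy => (fderivWithin_totalCost_eq_zero_iff hsmooth hYb hYc hLu hν.2 hx hy).symm.trans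
      (hS.fderivWithin_eq_zero_iff hT hT0 hx hy)) hv
  have hgen := fun hu => generalizedNested_of_unique hν.2 hpair hnest hu
  refine ⟨⟨_, v, hpair, hnest⟩, hgen, fun hXc hac => ?_, T, hT, hM.isOptimalMap,
    fun T' hT' => hM.ae_eq_of_isOptimalMap hT', fun k hk hsk => ?_⟩
  · have hu := hM.uniqueKantorovichPair hXo hXc.isPreconnected hsmooth.1 hac
    exact ⟨hu, hgen hu⟩
  · refine hS.contDiffOn_argmin hT hT0 ?_
    -- `T` solves an equation in the gradient of the total cost, which costs one derivative; the
    -- same `T` serves every `k`.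
    rw [Nat.sub_add_cancel (by omega)]
    exact hsk.contDiffOn_totalCost hYb hYc hLu hν.2
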